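/- **Setting.** All systems have separable Hilbert spaces (finite or countably infinite dimension), $\|\cdot\|$ is the trace norm, and a channel is a linear, completely positive, trace-preserving map on trace-class operators. A *trace-preserving LOCC* between Alice and Bob is a channel realized by finitely many rounds; in each round one party applies a local quantum instrument (with discrete or continuous outcomes), the outcome is broadcast and may determine all later rounds, and one averages over all outcomes. An *adaptive protocol* with $n$ uses of a channel $\mathcal E$ from Alice to Bob starts with a product of local states, to which a trace-preserving LOCC $\Lambda_0$ is applied, giving $\rho^0_{\mathbf{ab}}$. In the $i$-th use ($i=1,\dots,n$) Alice sends a system $a_i$ of her register through $\mathcal E$, Bob adds the output to his register, and a trace-preserving LOCC $\Lambda_i$ is applied to the registers: $$\rho^{i}_{\mathbf{ab}}=\Lambda_i\circ(\mathcal I_{\mathbf a}\otimes\mathcal E\otimes\mathcal I_{\mathbf b})(\rho^{i-1}_{\mathbf{ab}}).$$ The output is $\rho^n_{\mathbf{ab}}$. The channel $\mathcal E$ is *stretchable into* a bipartite state $\sigma$ if there is a trace-preserving LOCC $\mathcal T$ with $\mathcal E(\rho)=\mathcal T(\rho\otimes\sigma)$ for all states $\rho$, where Alice holds the input and her part of $\sigma$,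 and Bob holds his part of $\sigma$ and obtains the output. If the input dimension $d$ is finite, $\mathcal E$ is *Choi-stretchable* if it is stretchable into its Choi matrix $\rho_{\mathcal E}=(\mathcal I\otimes\mathcal E)(|\Phi\rangle\langle\Phi|)$, $|\Phi\rangle=d^{-1/2}\sum_i|i\rangle|i\rangle$. An *asymptotic simulation* of $\mathcal E$ is a family of trace-preserving LOCCs $\mathcal T^\mu$ and states $\sigma^\mu$ such that the channels $\mathcal E^\mu(\rho)=\mathcal T^\mu(\rho\otimes\sigma^\mu)$ satisfy $\|(\mathcal I\otimes\mathcal E)(\rho)-(\mathcal I\otimes\mathcal E^\mu)(\rho)\|\to0$ in the limit of $\mu$, for every state $\rho$ of the input and an arbitrary ancilla. **Lemma (Stretching).** Consider any adaptive protocol with $n\ge 0$ uses of a channel $\mathcal E$. 1. If $\mathcal E$ is stretchable into $\sigma$, then $\rho^n_{\mathbf{ab}}=\bar\Lambda(\sigma^{\otimes n})$ for some trace-preserving LOCC $\bar\Lambda$, with respect to the bipartition in which Alice holds her $n$ parts of $\sigma^{\otimes n}$ and Bob holds his. 2. If $\mathcal E$ has finite-dimensional input and is Choi-stretchable, then $\rho^n_{\mathbf{ab}}=\bar\Lambda(\rho_{\mathcal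 E}^{\otimes n})$ for some trace-preserving LOCC $\bar\Lambda$. 3. If $\mathcal E$ has an asymptotic simulation $(\mathcal T^\mu,\sigma^\mu)$, then there are trace-preserving LOCCs $\bar\Lambda_\mu$ such that the output $\rho^{n,\mu}_{\mathbf{ab}}$ of the protocol with $\mathcal E$ replaced by $\mathcal E^\mu$ is $\rho^{n,\mu}_{\mathbf{ab}}=\bar\Lambda_\mu((\sigma^{\mu})^{\otimes n})$ for every $\mu$, and $\|\rho^n_{\mathbf{ab}}-\bar\Lambda_\mu((\sigma^{\mu})^{\otimes n})\|\to0$ in the limit of $\mu$. 4. In particular, let the input of $\mathcal E$ consist of finitely many bosonic modes, let $\Phi^\mu$, $\mu=\bar n+\tfrac12$, be the product over these modes of two-mode squeezed vacuum states with mean photon number $\bar n\ge0$ in each mode, and let $\mathcal E$ have an asymptotic simulation, for $\mu\to\infty$, with $\sigma^\mu=\rho^\mu_{\mathcal E}:=(\mathcal I\otimes\mathcal E)(\Phi^\mu)$. Then there are trace-preserving LOCCs $\bar\Lambda_\mu$ with $\rho^{n,\mu}_{\mathbf{ab}}=\bar\Lambda_\mu((\rho_{\mathcal E}^{\mu})^{\otimes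 n})$ for every $\mu$ and $\|\rho^n_{\mathbf{ab}}-\bar\Lambda_\mu((\rho^\mu_{\mathcal E})^{\otimes n})\|\to0$ as $\mu\to\infty$. 5. Let the input and output of $\mathcal E$ consist of finitely many bosonic modes, let $(\mathcal T^\mu,\sigma^\mu)$ be an asymptotic simulation of $\mathcal E$, and put $\|\mathcal E-\mathcal E^\mu\|_{\diamond N}=\sup_\rho\|(\mathcal I\otimes\mathcal E)(\rho)-(\mathcal I\otimes\mathcal E^\mu)(\rho)\|$, the supremum being over the states $\rho$ of a bosonic ancilla and the input with total mean photon number at most $N$. Then $\|\mathcal E-\mathcal E^\mu\|_{\diamond N}\to0$ for every $N<\infty$. If, moreover, the registers of the protocol are bosonic, then the LOCCs $\bar\Lambda_\mu$ of part 3 satisfy: whenever, for a given $\mu$, the total register states $\rho^i_{\mathbf{ab}}$ and $\rho^{i,\mu}_{\mathbf{ab}}$ have mean photon number at most $N(i)$ for $0\le i<n$, $$\|\rho^n_{\mathbf{ab}}-\bar\Lambda_\mu((\sigma^{\mu})^{\otimes n})\|\le\sum_{i=0}^{n-1}\|\mathcal E-\mathcal E^\mu\|_{\diamond N(i)}.$$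 -/

import Mathlib

open scoped ENNReal NNReal ComplexOrder Topology
open MeasureTheory Filter

namespace Stretching

noncomputable section

/-! ### Operators, states, trace norm

A separable Hilbert space is written as `ℓ²(X)`, where the countable type `X` labels an orthonormal
basis; the tensor product of `ℓ²(X)` and `ℓ²(Y)` is `ℓ²(X × Y)`.  Operators are given by their
matrices in these bases. -/

/-- Matrices of operators on `ℓ²(X)`. -/
abbrev Op (X : Type) := Matrix X X ℂ

/-- A positive trace-class operator: a positive kernel with summable diagonal. -/
def IsPositiveTC {X : Type} (ρ : Op X) : Prop :=
  ρ.PosSemidef ∧ Summable fun x => ρ x x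

/-- A trace-class operator: a linear combination of positive trace-class operators. -/
def IsTraceClass {X : Type} (ρ : Op X) : Prop :=
  ρ ∈ Submodule.span ℂ {τ : Op X | IsPositiveTC τ}

/-- A density operator: positive with trace one. -/
def IsState {X : Type} (ρ : Op X) : Prop :=
  ρ.PosSemidef ∧ HasSum (fun x => ρ x x) 1

open Classical in
/-- The trace norm `‖M‖ = sup {|Tr (B M)| : ‖B‖ ≤ 1}`, as the dual of the operator norm; it is
enough to let `B` run over the contractions that live on finitely many basis vectors. -/
def traceNorm {X : Type} (M : Op X) : ℝ≥0∞ :=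
  ⨆ (F : Finset X) (B : Matrix F F ℂ) (_ : (1 - B.conjTranspose * B).PosSemidef),
    ‖(B * M.submatrix (fun x : F => (x : X)) (fun x : F => (x : X))).trace‖ₑ

/-- The tensor product of two operators. -/
def tensor {X Y : Type} (ρ : Op X) (τ : Op Y) : Op (X × Y) :=
  fun p q => ρ p.1 q.1 * τ p.2 q.2

/-- The rank-one operator `|ψ⟩⟨ψ|`. -/
def ketBra {X : Type} (ψ : X → ℂ) : Op X :=
  fun x y => ψ x * star (ψ y)

/-! ### Channels -/

/-- `I_R ⊗ Φ`, computed block by block. -/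
def onRight {X X' : Type} (R : Type) (Φ : Op X → Op X') (ρ : Op (R × X)) : Op (R × X') :=
  fun p q => Φ (fun x x' => ρ (p.1, x) (q.1, x')) p.2 q.2

/-- `Φ ⊗ I_R`, computed block by block. -/
def onLeft {X X' : Type} (R : Type) (Φ : Op X → Op X') (ρ : Op (X × R)) : Op (X' × R) :=
  fun p q => Φ (fun x x' => ρ (x, p.2) (x', q.2)) p.1 q.1

/-- A quantum channel: a linear, completely positive and trace-preserving map between the
trace-class operators on `ℓ²(X)` and those on `ℓ²(Y)`. (The values of `Φ` on matrices that are not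
trace class play no role.) -/
structure IsChannel {X Y : Type} (Φ : Op X → Op Y) : Prop where
  map_add : ∀ ρ τ, IsTraceClass ρ → IsTraceClass τ → Φ (ρ + τ) = Φ ρ + Φ τ
  map_smul : ∀ (c : ℂ) (ρ), IsTraceClass ρ → Φ (c • ρ) = c • Φ ρ
  traceClass : ∀ ρ, IsTraceClass ρ → IsTraceClass (Φ ρ)
  completelyPositive : ∀ (m : ℕ) (ρ : Op (Fin m × X)), IsPositiveTC ρ →
    (onRight (Fin m) Φ ρ).PosSemidef
  tracePreserving : ∀ ρ, IsTraceClass ρ → ∑' y, Φ ρ y y = ∑' x, ρ x x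

/-- A quantum instrument with outcomes in the measure space `(K, ν)`, discrete or continuous.
`J k` is the completely positive map of the outcome `k`, as a density with respect to `ν`, so that
the outcome of a measurement on `ρ` has probability density `Tr (J k ρ)`. As usual for densities,
the laws are required for almost every `k`, for each input. -/
structure IsInstrument {K : Type} [MeasurableSpace K] (ν : Measure K) {X Y : Type}
    (J : K → Op X → Op Y) : Prop where
  aemeasurable : ∀ ρ, IsTraceClass ρ → ∀ y y', AEMeasurable (fun k => J k ρ y y') ν
  map_add : ∀ ρ τ, IsTraceClass ρ → IsTraceClass τ →
    ∀ᵐ k ∂ν, J k (ρ + τ) = J k ρ + J k τ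
  map_smul : ∀ (c : ℂ) (ρ), IsTraceClass ρ → ∀ᵐ k ∂ν, J k (c • ρ) = c • J k ρ
  traceClass : ∀ ρ, IsTraceClass ρ → ∀ᵐ k ∂ν, IsTraceClass (J k ρ)
  completelyPositive : ∀ (m : ℕ) (ρ : Op (Fin m × X)), IsPositiveTC ρ →
    ∀ᵐ k ∂ν, (onRight (Fin m) (J k) ρ).PosSemidef
  total : ∀ ρ, IsPositiveTC ρ →
    ∫⁻ k, ∑' y, ENNReal.ofReal (J k ρ y y).re ∂ν = ∑' x, ENNReal.ofReal (ρ x x).re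

/-! ### Local operations and classical communication -/

/-- `LOCCRounds A B A' B' r Λ`: the channel `Λ` from Alice's and Bob's systems `A`, `B` to
`A'`, `B'` is implemented by local operations and classical communication with `r` rounds,
averaged over all measurement outcomes. In a round one of the parties applies an instrument to the
local system and broadcasts the outcome `k`; the remaining rounds `Θ k` may depend on `k`.
(The condition `IsChannel Λ` only fixes `Λ` by linearity outside the states.) -/
inductive LOCCRounds : (A B A' B' : Type) → ℕ → (Op (A × B) → Op (A' × B')) → Prop
  | done {A B : Type} (Λ : Op (A × B) → Op (A × B)) (hΛ : IsChannel Λ)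
      (h : ∀ ρ, IsState ρ → Λ ρ = ρ) :
      LOCCRounds A B A B 0 Λ
  | alice {A B A₁ A' B' : Type} [Countable A₁] {r : ℕ}
      {K : Type} [MeasurableSpace K] (ν : Measure K) [SigmaFinite ν]
      (J : K → Op A → Op A₁) (hJ : IsInstrument ν J)
      (Θ : K → Op (A₁ × B) → Op (A' × B')) (hΘ : ∀ k, LOCCRounds A₁ B A' B' r (Θ k))
      (hm : ∀ ω, IsTraceClass ω → ∀ x y, AEMeasurable (fun k => Θ k ω x y) ν)
      (Λ : Op (A × B) → Op (A' × B')) (hΛ : IsChannel Λ)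
      (h : ∀ ρ, IsState ρ → ∀ x y, Λ ρ x y = ∫ k, Θ k (onLeft B (J k) ρ) x y ∂ν) :
      LOCCRounds A B A' B' (r + 1) Λ
  | bob {A B B₁ A' B' : Type} [Countable B₁] {r : ℕ}
      {K : Type} [MeasurableSpace K] (ν : Measure K) [SigmaFinite ν]
      (J : K → Op B → Op B₁) (hJ : IsInstrument ν J)
      (Θ : K → Op (A × B₁) → Op (A' × B')) (hΘ : ∀ k, LOCCRounds A B₁ A' B' r (Θ k))
      (hm : ∀ ω, IsTraceClass ω → ∀ x y, AEMeasurable (fun k => Θ k ω x y) ν)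
      (Λ : Op (A × B) → Op (A' × B')) (hΛ : IsChannel Λ)
      (h : ∀ ρ, IsState ρ → ∀ x y, Λ ρ x y = ∫ k, Θ k (onRight A (J k) ρ) x y ∂ν) :
      LOCCRounds A B A' B' (r + 1) Λ

/-- A trace-preserving LOCC from Alice's `A` and Bob's `B` to Alice's `A'` and Bob's `B'`. -/
def IsLOCC {A B A' B' : Type} (Λ : Op (A × B) → Op (A' × B')) : Prop :=
  IsChannel Λ ∧ ∃ r, LOCCRounds A B A' B' r Λ

/-! ### Systems -/

/-- A quantum system of countable dimension: the Hilbert space `ℓ²(idx)` with a total number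
operator, diagonal in the basis, with eigenvalues `number` (zero for systems without photons). -/
structure QSystem where
  idx : Type
  [countable : Countable idx]
  number : idx → ℕ

attribute [instance] QSystem.countable

namespace QSystem

/-- The trivial (one-dimensional) system. -/
abbrev triv : QSystem where
  idx := Unit
  number _ := 0

/-- The composite of two systems. -/
abbrev prod (X Y : QSystem) : QSystem where
  idx := X.idx × Y.idx
  number p := X.number p.1 + Y.number p.2

/-- `n` copies of a system. -/
abbrev pow (X : QSystem) (n : ℕ) : QSystem where
  idx := Fin n → X.idx
  number f := ∑ j, X.number (f j)

/-- The Fock space of the bosonic modes `M`: the basis is labelled by the finitely supported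
occupation numbers, and the number operator counts all photons. -/
abbrev modes (M : Type) [Countable M] : QSystem where
  idx := M →₀ ℕ
  number f := f.degree

/-- Bosonic systems: bosonic modes and composites of them. -/
inductive IsBosonic : QSystem → Prop
  | modes (M : Type) [Countable M] : IsBosonic (QSystem.modes M)
  | prod {X Y : QSystem} : IsBosonic X → IsBosonic Y → IsBosonic (X.prod Y)

/-- The mean photon number `Tr (N̂ ρ)`. -/
def meanNumber (X : QSystem) (ρ : Op X.idx) : ℝ≥0∞ :=
  ∑' x, ENNReal.ofReal (ρ x x).re * (X.number x : ℝ≥0∞)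

end QSystem

/-- `σ^{⊗ n}` for a bipartite `σ`, with the `n` systems of Alice collected on the left and the `n`
systems of Bob on the right. -/
def tensorPower {A B : QSystem} (σ : Op (A.prod B).idx) (n : ℕ) :
    Op ((A.pow n).prod (B.pow n)).idx :=
  fun p q => ∏ j, σ (p.1 j, p.2 j) (q.1 j, q.2 j)

/-! ### Adaptive protocols -/

/-- The transmission of the middle system: `I_K ⊗ E ⊗ I_S`, where Alice holds `K` and the input of
`E` before the transmission and Bob holds the output of `E` and `S` after it. -/
def transmission {a b : QSystem} (K S : QSystem) (E : Op a.idx → Op b.idx)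
    (ρ : Op ((K.prod a).prod S).idx) : Op (K.prod (b.prod S)).idx :=
  fun p q => E (fun x x' => ρ ((p.1, x), p.2.2) ((q.1, x'), q.2.2)) p.2.1 q.2.1

/-- `AdaptiveProtocol a b n A B`: an adaptive protocol that uses `n` times a channel from `a`
(Alice) to `b` (Bob) and ends with the registers `A` of Alice and `B` of Bob. Local states are
prepared and processed by the LOCC `Λ₀`; in each transmission, Alice picks a system `a` out of her
register `K ⊗ a` and sends it, Bob adds the output `b` to his register `S`, and both apply the next
LOCC `Λ` to their registers. -/
inductive AdaptiveProtocol (a b : QSystem) : ℕ → QSystem → QSystem → Type 1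
  | prepare {A₀ B₀ A B : QSystem} (ρA : Op A₀.idx) (hA : IsState ρA)
      (ρB : Op B₀.idx) (hB : IsState ρB)
      (Λ₀ : Op (A₀.prod B₀).idx → Op (A.prod B).idx) (hΛ₀ : IsLOCC Λ₀) :
      AdaptiveProtocol a b 0 A B
  | transmit {n : ℕ} {K S A B : QSystem} (P : AdaptiveProtocol a b n (K.prod a) S)
      (Λ : Op (K.prod (b.prod S)).idx → Op (A.prod B).idx) (hΛ : IsLOCC Λ) :
      AdaptiveProtocol a b (n + 1) A B

namespace AdaptiveProtocol

variable {a b : QSystem}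

/-- The output state of the protocol when the channel used is `E`. -/
def output (E : Op a.idx → Op b.idx) :
    {n : ℕ} → {A B : QSystem} → AdaptiveProtocol a b n A B → Op (A.prod B).idx
  | _, _, _, prepare ρA _ ρB _ Λ₀ _ => Λ₀ (tensor ρA ρB)
  | _, _, _, @transmit _ _ _ K S _ _ P Λ _ => Λ (transmission K S E (P.output E))

/-- The registers kept during each transmission are bosonic. -/
def HasBosonicRegisters :
    {n : ℕ} → {A B : QSystem} → AdaptiveProtocol a b n A B → Prop
  | _, _, _, prepare _ _ _ _ _ _ => True
  | _, _, _, @transmit _ _ _ K S _ _ P _ _ =>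
      K.IsBosonic ∧ S.IsBosonic ∧ P.HasBosonicRegisters

/-- When the channel used is `E`, the total register state after `i` transmissions has at most
`N i` photons on average, for every `i` smaller than the number of transmissions. -/
def EnergyBounded (E : Op a.idx → Op b.idx) (N : ℕ → ℝ≥0) :
    {n : ℕ} → {A B : QSystem} → AdaptiveProtocol a b n A B → Prop
  | _, _, _, prepare _ _ _ _ _ _ => True
  | _, _, _, @transmit _ _ n K S _ _ P _ _ =>
      ((K.prod a).prod S).meanNumber (P.output E) ≤ N n ∧ P.EnergyBounded E N

end AdaptiveProtocol

/-! ### Simulation of channels -/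

/-- The map `ρ ↦ T (ρ ⊗ σ)`: Alice holds the input `a` and her part `A` of the resource `σ`, Bob
holds his part `B` and gets the output `b`. -/
def simulate {a b A B : QSystem}
    (T : Op ((a.prod A).prod B).idx → Op (QSystem.triv.prod b).idx)
    (σ : Op (A.prod B).idx) (ρ : Op a.idx) : Op b.idx :=
  fun y y' => T (fun p q => ρ p.1.1 q.1.1 * σ (p.1.2, p.2) (q.1.2, q.2)) ((), y) ((), y')

/-- The channel `E` is stretchable into the bipartite state `σ`: `E ρ = T (ρ ⊗ σ)` for a
trace-preserving LOCC `T`. -/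
def IsStretchable {a b A B : QSystem} (E : Op a.idx → Op b.idx) (σ : Op (A.prod B).idx) : Prop :=
  IsState σ ∧ ∃ T : Op ((a.prod A).prod B).idx → Op (QSystem.triv.prod b).idx,
    IsLOCC T ∧ ∀ ρ, IsState ρ → E ρ = simulate T σ ρ

/-- `(T i, σ i)` is, along the filter `l`, an asymptotic simulation of `E`: the channels
`ρ ↦ T i (ρ ⊗ σ i)` converge to `E` pointwise in trace norm, on all states of the input and an
arbitrary ancilla. -/
def IsAsymptoticSimulation {I : Type} (l : Filter I) {a b A B : QSystem}
    (E : Op a.idx → Op b.idx)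
    (T : I → Op ((a.prod A).prod B).idx → Op (QSystem.triv.prod b).idx)
    (σ : I → Op (A.prod B).idx) : Prop :=
  (∀ i, IsLOCC (T i)) ∧ (∀ i, IsState (σ i)) ∧
    ∀ (R : QSystem) (ρ : Op (R.prod a).idx), IsState ρ →
      Tendsto (fun i => traceNorm
        (onRight R.idx E ρ - onRight R.idx (simulate (T i) (σ i)) ρ)) l (𝓝 0)

open Classical in
/-- The maximally entangled vector `d^{-1/2} ∑ᵢ |i⟩|i⟩` of two `d`-dimensional systems. -/
def bellVector (a : QSystem) : (a.prod a).idx → ℂ :=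
  fun p => if p.1 = p.2 then ((1 / √(Nat.card a.idx : ℝ) : ℝ) : ℂ) else 0

/-- The Choi matrix `(I ⊗ E)(Φ)` of a channel with finite-dimensional input. -/
def choi {a b : QSystem} (E : Op a.idx → Op b.idx) : Op (a.prod b).idx :=
  onRight a.idx E (ketBra (bellVector a))

open Classical in
/-- The product over the finitely many modes `m ∈ M` of the two-mode squeezed vacuum vectors
`∑ₖ √(t^k / (t + 1)^(k + 1)) |k⟩|k⟩` with `t` thermal photons in each mode. -/
def tmsvVector (M : Type) [Finite M] (t : ℝ≥0) :
    ((QSystem.modes M).prod (QSystem.modes M)).idx → ℂ :=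
  fun p => if p.1 = p.2 then
    ((√((t : ℝ) ^ p.1.degree / ((t : ℝ) + 1) ^ (p.1.degree + Nat.card M)) : ℝ) : ℂ) else 0

/-- The quasi-Choi matrix `(I ⊗ E)(Φ^μ)` of a bosonic channel, with `μ = t + 1/2`. -/
def quasiChoi {M : Type} [Finite M] {b : QSystem} (E : Op (QSystem.modes M).idx → Op b.idx)
    (t : ℝ≥0) : Op ((QSystem.modes M).prod b).idx :=
  onRight (QSystem.modes M).idx E (ketBra (tmsvVector M t))

/-- The energy-bounded diamond distance `‖E₁ - E₂‖_{⋄N}`: the supremum of the trace norm of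
`(I ⊗ E₁)(ρ) - (I ⊗ E₂)(ρ)` over the states `ρ` of a bosonic ancilla and the input with total mean
photon number at most `N`. -/
def boundedDiamond {a b : QSystem} (E₁ E₂ : Op a.idx → Op b.idx) (N : ℝ≥0) : ℝ≥0∞ :=
  ⨆ (R : QSystem) (_ : R.IsBosonic) (ρ : Op (R.prod a).idx) (_ : IsState ρ)
    (_ : (R.prod a).meanNumber ρ ≤ N), traceNorm (onRight R.idx E₁ ρ - onRight R.idx E₂ ρ)

end

end Stretching

/-! A use of the channel on `ρ` can be replaced by a LOCC on `ρ ⊗ σ`, and the copy of `σ` may be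
distributed before the protocol begins. By induction on the number of uses, local preparation,
simulations and intermediate LOCCs collapse into a single LOCC acting on `σ^{⊗n}`
(`AdaptiveProtocol.exists_stretching`). This needs LOCCs to be closed under composition and under
adjoining passive local systems (`LOCCRounds.comp`, `LOCCRounds.withMemory`).

Both closure properties are analytic, because outcomes may be continuous, instruments obey their
laws only almost everywhere for each input, and identities are given on states only. Polarization
writes an off-diagonal block of a positive operator as a combination of positive ones, so identities
on states pass to all blocks of a larger state. Channels are recovered entrywise from finite
truncations (`IsChannel.tendsto_apply_trunc`), hence they commute with averages
(`IsChannel.apply_integral`).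

For asymptotic simulations, the exact result applies to each simulating channel. Errors are peeled
off one use at a time: channels contract the trace distance (`IsChannel.traceNorm_sub_le`), and each
use adds the simulation error on the register state of the ideal protocol, which does not depend on
the simulation parameter.

For bounded energy, Markov's inequality confines the input to finitely many Fock vectors up to a
uniformly small tail. On finitely many input vectors, pointwise convergence is uniform over all
ancillas, since only the finitely many matrix units of the input matter (`tendsto_boundedDiamond`).
-/

namespace Stretching

/-! ### Positive semidefinite kernels on infinite index sets. -/

section Positivity

variable {X Y : Type}

/-- Test vectors are finitely supported, so the quadratic form only sees finite corners. -/
theorem posSemidef_of_finset {M : Op X}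
    (h : ∀ F : Finset X, (M.submatrix (fun x : F => (x : X)) fun x : F => (x : X)).PosSemidef) :
    M.PosSemidef := by
  classical
  refine ⟨?_, fun v => ?_⟩
  · ext x y
    have := (h {x, y}).1.apply ⟨x, by simp⟩ ⟨y, by simp⟩
    simpa using this
  · have := (h v.support).dotProduct_mulVec_nonneg fun x => v x
    simp only [dotProduct, Matrix.mulVec, Finset.mul_sum, Matrix.submatrix_apply, Pi.star_apply]
      at this
    rw [Finset.sum_coe_sort v.support (fun x => ∑ y : v.support, star (v x) * (M x y * v y))]
      at this
    simp only [Finsupp.sum]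
    refine this.trans_eq (Finset.sum_congr rfl fun x _ => ?_)
    rw [Finset.sum_coe_sort v.support (fun y => star (v x) * (M x y * v y))]
    simp [mul_assoc]

/-- Points may repeat in `u`. This matches the ancillas `Fin m` of complete positivity, where
several test points can share an ancilla index. -/
theorem posSemidef_of_fin {M : Op X}
    (h : ∀ (m : ℕ) (u : Fin m → X), (M.submatrix u u).PosSemidef) : M.PosSemidef := by
  refine posSemidef_of_finset fun F => ?_
  have := (h F.card fun i => (F.equivFin.symm i : X)).submatrix F.equivFin
  simpa [Matrix.submatrix_submatrix, Function.comp_def] using this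

theorem posSemidef_conj {Z : Type} [Fintype Z] {M : Op Z} (hM : M.PosSemidef) (C : X → Z → ℂ) :
    Matrix.PosSemidef (fun x y => ∑ z, ∑ z', C x z * M z z' * star (C y z') : Op X) := by
  refine posSemidef_of_fin fun m u => ?_
  convert hM.mul_mul_conjTranspose_same (Matrix.of fun i z => C (u i) z : Matrix (Fin m) Z ℂ)
    using 1
  ext i j
  simp only [Matrix.mul_apply, Matrix.of_apply,
    Matrix.conjTranspose_apply, Finset.sum_mul]
  exact Finset.sum_comm

theorem posSemidef_weight {M : Op X} (hM : M.PosSemidef) (w : X → ℂ) :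
    Matrix.PosSemidef (fun x y => w x * M x y * star (w y) : Op X) := by
  classical
  refine posSemidef_of_fin fun m u => ?_
  refine (congrArg Matrix.PosSemidef ?_).mpr
    (posSemidef_conj (hM.submatrix u) fun i j => if i = j then w (u i) else 0)
  ext i j
  change w (u i) * M (u i) (u j) * star (w (u j)) = _
  simp [apply_ite (starRingEnd ℂ)]

/-- On finitely many points the tensor product is a Schur product, that is, the diagonal corner `i ↦
(i, i)` of a Kronecker product. -/
theorem posSemidef_tensor {ρ : Op X} {τ : Op Y} (hρ : ρ.PosSemidef) (hτ : τ.PosSemidef) :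
    (tensor ρ τ).PosSemidef := by
  refine posSemidef_of_fin fun m u => ?_
  exact ((hρ.submatrix fun i => (u i).1).kronecker (hτ.submatrix fun i => (u i).2)).submatrix
    fun i : Fin m => (i, i)

/-- This is `C M C*` for the row `C = (1, c)` acting on the two families of points `f` and `g`.
Letting `c` run over the fourth roots of unity yields polarization. -/
theorem posSemidef_combination {M : Op X} (hM : M.PosSemidef) (f g : Y → X) (c : ℂ) :
    Matrix.PosSemidef (fun y y' => M (f y) (f y') + star c * M (f y) (g y') + c * M (g y) (f y') +
      c * star c * M (g y) (g y') : Op Y) := by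
  classical
  refine posSemidef_of_fin fun m u => ?_
  refine (congrArg Matrix.PosSemidef ?_).mpr
    (posSemidef_conj (hM.submatrix (Sum.elim (fun i => f (u i)) fun i => g (u i)))
      fun i : Fin m => Sum.elim (fun j => if i = j then 1 else 0) fun j => if i = j then c else 0)
  ext i j
  change M (f (u i)) (f (u j)) + star c * M (f (u i)) (g (u j)) + c * M (g (u i)) (f (u j)) +
    c * star c * M (g (u i)) (g (u j)) = _
  simp only [Matrix.submatrix_apply, Fintype.sum_sum_type, Sum.elim_inl, Sum.elim_inr]
  simp [Finset.sum_add_distrib, apply_ite (starRingEnd ℂ)]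
  ring

end Positivity

/-! ### Traces of positive operators, trace-class operators and polarization. -/

section Trace

variable {X Y : Type}

/-- The trace of a positive operator. -/
noncomputable def posTrace (ρ : Op X) : ℝ≥0∞ := ∑' x, ENNReal.ofReal (ρ x x).re

theorem re_diag_nonneg {ρ : Op X} (h : ρ.PosSemidef) (x : X) : 0 ≤ (ρ x x).re :=
  (Complex.le_def.1 h.diag_nonneg).1

theorem diag_eq_re {ρ : Op X} (h : ρ.PosSemidef) (x : X) : ρ x x = ((ρ x x).re : ℂ) :=
  Complex.ext rfl (by simpa using (Complex.le_def.1 h.diag_nonneg).2.symm)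

theorem summable_diag_iff {ρ : Op X} (h : ρ.PosSemidef) :
    (Summable fun x => ρ x x) ↔ posTrace ρ ≠ ⊤ := by
  have : (fun x => ρ x x) = fun x => (((ρ x x).re : ℝ) : ℂ) := funext (diag_eq_re h)
  rw [this, Complex.summable_ofReal]
  refine ⟨fun hs => hs.tsum_ofReal_ne_top, fun ht => ?_⟩
  have := ENNReal.summable_toReal ht
  simpa [ENNReal.toReal_ofReal (re_diag_nonneg h _)] using this

theorem isPositiveTC_iff {ρ : Op X} : IsPositiveTC ρ ↔ ρ.PosSemidef ∧ posTrace ρ ≠ ⊤ :=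
  and_congr_right fun h => summable_diag_iff h

theorem IsPositiveTC.hasSum {ρ : Op X} (h : IsPositiveTC ρ) :
    HasSum (fun x => ρ x x) ((posTrace ρ).toReal : ℂ) := by
  have : (fun x => ρ x x) = fun x => (((ρ x x).re : ℝ) : ℂ) := funext (diag_eq_re h.1)
  rw [this, Complex.hasSum_ofReal]
  have := ENNReal.hasSum_toReal (isPositiveTC_iff.1 h).2
  simpa [ENNReal.toReal_ofReal (re_diag_nonneg h.1 _), posTrace,
    ENNReal.tsum_toReal_eq (fun _ => ENNReal.ofReal_ne_top)] using this

theorem isState_iff {ρ : Op X} : IsState ρ ↔ ρ.PosSemidef ∧ posTrace ρ = 1 := by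
  refine and_congr_right fun h => ⟨fun hs => ?_, fun ht => ?_⟩
  · have h1 : IsPositiveTC ρ := ⟨h, hs.summable⟩
    have := h1.hasSum.unique hs
    rw [← ENNReal.toReal_eq_one_iff]
    exact_mod_cast this
  · have h1 : IsPositiveTC ρ := isPositiveTC_iff.2 ⟨h, by simp [ht]⟩
    simpa [ht] using h1.hasSum

theorem IsState.isPositiveTC {ρ : Op X} (h : IsState ρ) : IsPositiveTC ρ := ⟨h.1, h.2.summable⟩

theorem IsPositiveTC.isTraceClass {ρ : Op X} (h : IsPositiveTC ρ) : IsTraceClass ρ :=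
  Submodule.subset_span h

theorem IsState.isTraceClass {ρ : Op X} (h : IsState ρ) : IsTraceClass ρ :=
  h.isPositiveTC.isTraceClass

theorem IsTraceClass.add {ρ τ : Op X} (hρ : IsTraceClass ρ) (hτ : IsTraceClass τ) :
    IsTraceClass (ρ + τ) := Submodule.add_mem _ hρ hτ

theorem IsTraceClass.sub {ρ τ : Op X} (hρ : IsTraceClass ρ) (hτ : IsTraceClass τ) :
    IsTraceClass (ρ - τ) := Submodule.sub_mem _ hρ hτ

theorem IsTraceClass.smul {ρ : Op X} (hρ : IsTraceClass ρ) (c : ℂ) :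
    IsTraceClass (c • ρ) := Submodule.smul_mem _ c hρ

theorem isTraceClass_zero : IsTraceClass (0 : Op X) := Submodule.zero_mem _

theorem isTraceClass_sum {ι : Type*} {s : Finset ι} {f : ι → Op X}
    (h : ∀ i ∈ s, IsTraceClass (f i)) : IsTraceClass (∑ i ∈ s, f i) := Submodule.sum_mem _ h

theorem IsTraceClass.induction {P : Op X → Prop} (hpos : ∀ ρ, IsPositiveTC ρ → P ρ)
    (hadd : ∀ ρ τ, IsTraceClass ρ → IsTraceClass τ → P ρ → P τ → P (ρ + τ))
    (hsmul : ∀ (c : ℂ) ρ, IsTraceClass ρ → P ρ → P (c • ρ)) {ρ : Op X} (hρ : IsTraceClass ρ) :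
    P ρ := by
  refine Submodule.span_induction (p := fun ρ _ => P ρ) hpos ?_ hadd hsmul hρ
  exact hpos 0 ⟨Matrix.PosSemidef.zero, by simp⟩

theorem IsTraceClass.summable {ρ : Op X} (hρ : IsTraceClass ρ) : Summable fun x => ρ x x :=
  hρ.induction (P := fun ρ => Summable fun x => ρ x x) (fun _ h => h.2)
    (fun _ _ _ _ h h' => h.add h') (fun c _ _ h => h.const_smul c)

theorem IsPositiveTC.of_isTraceClass {ρ : Op X} (h : ρ.PosSemidef) (h' : IsTraceClass ρ) :
    IsPositiveTC ρ := ⟨h, h'.summable⟩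

theorem posTrace_add {ρ τ : Op X} (hρ : ρ.PosSemidef) (hτ : τ.PosSemidef) :
    posTrace (ρ + τ) = posTrace ρ + posTrace τ := by
  simp only [posTrace, ← ENNReal.tsum_add]
  exact tsum_congr fun x => by
    simp [ENNReal.ofReal_add (re_diag_nonneg hρ x) (re_diag_nonneg hτ x)]

theorem posTrace_smul (ρ : Op X) {c : ℝ} (hc : 0 ≤ c) :
    posTrace ((c : ℂ) • ρ) = ENNReal.ofReal c * posTrace ρ := by
  simp only [posTrace, ← ENNReal.tsum_mul_left]
  exact tsum_congr fun x => by simp [ENNReal.ofReal_mul hc]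

theorem posSemidef_smul {ρ : Op X} (hρ : ρ.PosSemidef) {c : ℝ} (hc : 0 ≤ c) :
    ((c : ℂ) • ρ).PosSemidef := hρ.smul (by exact_mod_cast hc)

theorem IsPositiveTC.add {ρ τ : Op X} (hρ : IsPositiveTC ρ) (hτ : IsPositiveTC τ) :
    IsPositiveTC (ρ + τ) := ⟨hρ.1.add hτ.1, hρ.2.add hτ.2⟩

theorem IsPositiveTC.smul {ρ : Op X} (hρ : IsPositiveTC ρ) {c : ℝ} (hc : 0 ≤ c) :
    IsPositiveTC ((c : ℂ) • ρ) := ⟨posSemidef_smul hρ.1 hc, hρ.2.mul_left (c : ℂ)⟩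

theorem IsPositiveTC.posTrace_ne_top {ρ : Op X} (h : IsPositiveTC ρ) : posTrace ρ ≠ ⊤ :=
  (isPositiveTC_iff.1 h).2

theorem posTrace_submatrix_equiv (ρ : Op X) (e : Y ≃ X) :
    posTrace (ρ.submatrix e e) = posTrace ρ :=
  e.tsum_eq fun x => ENNReal.ofReal (ρ x x).re

theorem posTrace_submatrix_le (ρ : Op X) {f : Y → X} (hf : f.Injective) :
    posTrace (ρ.submatrix f f) ≤ posTrace ρ :=
  ENNReal.tsum_comp_le_tsum_of_injective hf fun x => ENNReal.ofReal (ρ x x).re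

theorem IsPositiveTC.submatrix {ρ : Op X} (h : IsPositiveTC ρ) {f : Y → X} (hf : f.Injective) :
    IsPositiveTC (ρ.submatrix f f) :=
  ⟨h.1.submatrix f, h.2.comp_injective hf⟩

theorem posTrace_prod (ρ : Op (X × Y)) :
    posTrace ρ = ∑' y, posTrace (fun x x' => ρ (x, y) (x', y)) := by
  simp only [posTrace]
  rw [ENNReal.tsum_comm, ENNReal.tsum_prod']

theorem posTrace_tensor {ρ : Op X} {τ : Op Y} (hρ : ρ.PosSemidef) (hτ : τ.PosSemidef) :
    posTrace (tensor ρ τ) = posTrace ρ * posTrace τ := by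
  simp only [posTrace, ENNReal.tsum_prod', tensor, ← ENNReal.tsum_mul_right]
  refine tsum_congr fun x => ?_
  rw [← ENNReal.tsum_mul_left]
  refine tsum_congr fun y => ?_
  rw [diag_eq_re hρ x, diag_eq_re hτ y, ← Complex.ofReal_mul, Complex.ofReal_re,
    Complex.ofReal_re, Complex.ofReal_re, ENNReal.ofReal_mul (re_diag_nonneg hρ x)]

/-- Polarization: an off-diagonal block of a positive operator is a combination of four positive
operators, whose traces are controlled by those of the diagonal blocks. -/
theorem exists_polarization {ρ : Op X} (hρ : ρ.PosSemidef) {f g : Y → X}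
    (hf : posTrace (ρ.submatrix f f) ≠ ⊤) (hg : posTrace (ρ.submatrix g g) ≠ ⊤) :
    ∃ τ : Fin 4 → Op Y, (∀ j, IsPositiveTC (τ j)) ∧
      (∀ j, posTrace (τ j) ≤ 2 * (posTrace (ρ.submatrix f f) + posTrace (ρ.submatrix g g))) ∧
      (fun y y' => ρ (f y) (g y') : Op Y) = ∑ j : Fin 4, (Complex.I ^ (j : ℕ) / 4) • τ j := by
  let τ : Fin 4 → Op Y := fun j y y' => ρ (f y) (f y') + star (Complex.I ^ (j : ℕ)) * ρ (f y) (g y')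
    + Complex.I ^ (j : ℕ) * ρ (g y) (f y') +
    Complex.I ^ (j : ℕ) * star (Complex.I ^ (j : ℕ)) * ρ (g y) (g y')
  have hτ : ∀ j, (τ j).PosSemidef := fun j => posSemidef_combination hρ f g _
  -- Parallelogram law: the diagonals of `τ j` and of `τ` at the opposite root of unity sum to the
  -- right-hand side, and both are nonnegative.
  have hdiag : ∀ j y, (τ j y y).re ≤ 2 * ((ρ (f y) (f y)).re + (ρ (g y) (g y)).re) := by
    intro j y
    have key : ∀ j' : Fin 4, 0 ≤ (τ j' y y).re := fun j' => re_diag_nonneg (hτ j') y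
    have k0 := key 0
    have k1 := key 1
    have k2 := key 2
    have k3 := key 3
    fin_cases j <;> simp [τ, pow_succ] at k0 k1 k2 k3 ⊢ <;> linarith
  have htr : ∀ j, posTrace (τ j) ≤
      2 * (posTrace (ρ.submatrix f f) + posTrace (ρ.submatrix g g)) := by
    intro j
    simp only [posTrace, ← ENNReal.tsum_add, ← ENNReal.tsum_mul_left, Matrix.submatrix_apply]
    refine ENNReal.tsum_le_tsum fun y => ?_
    rw [← ENNReal.ofReal_add (re_diag_nonneg hρ _) (re_diag_nonneg hρ _),
      show (2 : ℝ≥0∞) = ENNReal.ofReal 2 by simp, ← ENNReal.ofReal_mul (by norm_num)]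
    exact ENNReal.ofReal_le_ofReal (hdiag j y)
  refine ⟨τ, fun j => isPositiveTC_iff.2 ⟨hτ j, ne_top_of_le_ne_top ?_ (htr j)⟩, htr, ?_⟩
  · exact ENNReal.mul_ne_top (by simp) (ENNReal.add_ne_top.2 ⟨hf, hg⟩)
  -- In the sum over `j`, only the term with coefficient `I ^ j * star (I ^ j) = 1` survives.
  · ext y y'
    simp only [Matrix.sum_apply, Matrix.smul_apply, smul_eq_mul]
    simp [Fin.sum_univ_four, τ, pow_succ]
    ring_nf
    simp
    ring

theorem isTraceClass_block {ρ : Op X} (hρ : ρ.PosSemidef) {f g : Y → X}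
    (hf : posTrace (ρ.submatrix f f) ≠ ⊤) (hg : posTrace (ρ.submatrix g g) ≠ ⊤) :
    IsTraceClass (fun y y' => ρ (f y) (g y') : Op Y) := by
  obtain ⟨τ, h, -, e⟩ := exists_polarization hρ hf hg
  rw [e]
  exact isTraceClass_sum fun j _ => (h j).isTraceClass.smul _

theorem IsTraceClass.block {ρ : Op X} (hρ : IsTraceClass ρ) {f g : Y → X} (hf : f.Injective)
    (hg : g.Injective) : IsTraceClass (fun y y' => ρ (f y) (g y') : Op Y) := by
  refine hρ.induction (P := fun ρ => IsTraceClass (fun y y' => ρ (f y) (g y') : Op Y)) ?_ ?_ ?_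
  · intro ρ h
    exact isTraceClass_block h.1 (h.submatrix hf).posTrace_ne_top (h.submatrix hg).posTrace_ne_top
  · intro _ _ _ _ h h'
    exact h.add h'
  · intro c _ _ h
    exact h.smul c

theorem IsTraceClass.submatrix {ρ : Op X} (hρ : IsTraceClass ρ) {f : Y → X} (hf : f.Injective) :
    IsTraceClass (ρ.submatrix f f) := hρ.block hf hf

/-- A matrix unit is an off-diagonal block of the rank-one projection `N`, along the non-injective
maps `f a` and `f b` that send every point but one to the null vector `none`. -/
theorem isTraceClass_single [DecidableEq X] (a b : X) :
    IsTraceClass (Matrix.single a b (1 : ℂ) : Op X) := by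
  let N : Op (Option Unit) := Matrix.diagonal fun o => if o = none then 0 else 1
  have hN : N.PosSemidef := Matrix.PosSemidef.diagonal fun o => by
    dsimp only; split_ifs <;> simp
  let f : X → X → Option Unit := fun a x => if a = x then some () else none
  have hf : ∀ a, posTrace (N.submatrix (f a) (f a)) ≠ ⊤ := by
    intro a
    rw [posTrace, tsum_eq_single a]
    · simp
    · intro x hx
      simp [N, f, hx.symm]
  refine (congrArg IsTraceClass ?_).mpr (isTraceClass_block hN (hf a) (hf b))
  ext x y
  by_cases hx : a = x <;> by_cases hy : b = y <;> simp [Matrix.single, N, f, hx, hy]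

end Trace

/-! ### Trace duality for finite matrices. -/

section FiniteMatrices

open Matrix

variable {ι : Type*} [Fintype ι] [DecidableEq ι]

open scoped MatrixOrder Matrix.Norms.L2Operator in
theorem trace_mul_nonneg {M N : Matrix ι ι ℂ} (hM : M.PosSemidef) (hN : N.PosSemidef) :
    0 ≤ (M * N).trace := by
  obtain ⟨C, rfl⟩ : ∃ C : Matrix ι ι ℂ, N = C * Cᴴ := by
    obtain ⟨B, hB⟩ := CStarAlgebra.nonneg_iff_eq_star_mul_self.mp hN.nonneg
    exact ⟨Bᴴ, by simpa [star_eq_conjTranspose] using hB⟩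
  rw [← Matrix.mul_assoc, Matrix.trace_mul_comm, ← Matrix.mul_assoc]
  exact (hM.conjTranspose_mul_mul_same C).trace_nonneg

/-- Choose a phase `c` making `c * tr (B N)` equal to its modulus. The positive matrix `(1 - Bᴴ B) +
(1 - c B)ᴴ (1 - c B)` equals `2 - c B - (c B)ᴴ`. Its pairing with `N` is `2 tr N - 2 |tr (B N)|`, so
this is nonnegative. -/
theorem norm_trace_mul_le {B N : Matrix ι ι ℂ} (hB : (1 - Bᴴ * B).PosSemidef)
    (hN : N.PosSemidef) : ‖(B * N).trace‖ ≤ N.trace.re := by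
  obtain ⟨c, hc, hcz⟩ : ∃ c : ℂ, c * star c = 1 ∧ c * (B * N).trace = ‖(B * N).trace‖ := by
    obtain ⟨c, hc, h⟩ := RCLike.exists_norm_eq_mul_self (B * N).trace
    refine ⟨c, ?_, h.symm⟩
    have := Complex.normSq_eq_conj_mul_self (z := c)
    rw [Complex.normSq_eq_norm_sq, hc] at this
    simpa [mul_comm] using this.symm
  have h1 := trace_mul_nonneg
    (hB.add (posSemidef_conjTranspose_mul_self (1 - c • B))) hN
  have h2 : (Bᴴ * N).trace = star (B * N).trace := by
    rw [← trace_conjTranspose, conjTranspose_mul, hN.1.eq, Matrix.trace_mul_comm]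
  have h3 : 1 - Bᴴ * B + (1 - c • B)ᴴ * (1 - c • B) =
      (2 : ℂ) • (1 : Matrix ι ι ℂ) - c • B - star c • Bᴴ := by
    simp only [conjTranspose_sub, conjTranspose_one, conjTranspose_smul, sub_mul, mul_sub, one_mul,
      mul_one, smul_mul_assoc, mul_smul_comm, smul_sub, smul_smul, hc]
    module
  have h4 : star c * star (B * N).trace = ‖(B * N).trace‖ := by
    rw [← star_mul', hcz]; simp
  rw [h3] at h1
  simp only [sub_mul, smul_mul_assoc, one_mul, trace_sub, trace_smul, smul_eq_mul, h2, hcz, h4]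
    at h1
  have := (Complex.le_def.1 h1).1
  simp at this
  linarith

/-- `P`, `N` and `S` are the positive part, the negative part and the sign of `H` in its spectral
decomposition. `S` vanishes on the kernel of `H`, hence is a contraction but not necessarily
unitary. -/
theorem exists_sign_decomposition {H : Matrix ι ι ℂ} (hH : H.IsHermitian) :
    ∃ P N S : Matrix ι ι ℂ, P.PosSemidef ∧ N.PosSemidef ∧ (1 - Sᴴ * S).PosSemidef ∧
      H = P - N ∧ (S * H).trace = P.trace + N.trace := by
  set U : Matrix ι ι ℂ := ↑hH.eigenvectorUnitary with hU
  have hUU : Uᴴ * U = 1 := by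
    rw [← star_eq_conjTranspose]; exact Unitary.coe_star_mul_self hH.eigenvectorUnitary
  have hUU' : U * Uᴴ = 1 := by
    rw [← star_eq_conjTranspose]; exact Unitary.coe_mul_star_self hH.eigenvectorUnitary
  let D : (ι → ℝ) → Matrix ι ι ℂ := fun d => U * diagonal (fun i => (d i : ℂ)) * Uᴴ
  have hD : ∀ d, (∀ i, 0 ≤ d i) → (D d).PosSemidef := fun d hd =>
    (Matrix.PosSemidef.diagonal fun i => by
      simpa using hd i).mul_mul_conjTranspose_same U
  have hmul : ∀ d d', D d * D d' = D (d * d') := by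
    intro d d'
    have : D d * D d' = U * diagonal (fun i => (d i : ℂ)) * (Uᴴ * U) *
        diagonal (fun i => (d' i : ℂ)) * Uᴴ := by simp only [D, Matrix.mul_assoc]
    rw [this, hUU, Matrix.mul_one, Matrix.mul_assoc U, diagonal_mul_diagonal]
    simp [D]
  have hsub : ∀ d d', D d - D d' = D (d - d') := by
    intro d d'
    simp only [D, ← sub_mul, ← mul_sub, diagonal_sub]
    simp
  have hadd : ∀ d d', D d + D d' = D (d + d') := by
    intro d d'
    simp only [D, ← add_mul, ← mul_add, diagonal_add]
    simp
  have hone : D 1 = 1 := by simp [D, hUU']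
  have hstar : ∀ d, (D d)ᴴ = D d := by
    intro d
    simp only [D, conjTranspose_mul, conjTranspose_conjTranspose, diagonal_conjTranspose,
      Matrix.mul_assoc]
    congr 3
    ext i; simp
  have hHD : H = D hH.eigenvalues := by
    have := hH.spectral_theorem
    rw [Unitary.conjStarAlgAut_apply] at this
    simpa [D, star_eq_conjTranspose, Function.comp_def] using this
  set l := hH.eigenvalues
  refine ⟨D fun i => max (l i) 0, D fun i => max (-l i) 0, D fun i => SignType.sign (l i),
    hD _ fun i => le_max_right _ _, hD _ fun i => le_max_right _ _, ?_, ?_, ?_⟩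
  · rw [hstar, hmul, ← hone, hsub]
    refine hD _ fun i => ?_
    rcases lt_trichotomy (l i) 0 with h | h | h <;> simp [h]
  · rw [hsub, hHD]
    congr 1
    ext i
    rcases le_total (l i) 0 with h | h <;> simp [h]
  · rw [← trace_add, hadd]
    conv_lhs => rw [hHD]
    rw [hmul]
    congr 2
    ext i
    rcases lt_trichotomy (l i) 0 with h | h | h
    · simp [h, h.le]
    · simp [h]
    · simp [h, h.le]

end FiniteMatrices

/-! ### The trace norm as a dual norm. -/

section TraceNorm

variable {X Y : Type}

theorem le_traceNorm (M : Op X) {F : Finset X} [DecidableEq F] {B : Matrix F F ℂ}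
    (hB : (1 - B.conjTranspose * B).PosSemidef) :
    ‖(B * M.submatrix (fun x : F => (x : X)) (fun x : F => (x : X))).trace‖ₑ ≤ traceNorm M := by
  unfold traceNorm
  refine le_iSup_of_le F (le_iSup_of_le B (le_iSup_of_le ?_ le_rfl))
  convert hB

theorem traceNorm_le {M : Op X} {c : ℝ≥0∞}
    (h : ∀ (F : Finset X) (_ : DecidableEq F) (B : Matrix F F ℂ),
      (1 - B.conjTranspose * B).PosSemidef →
      ‖(B * M.submatrix (fun x : F => (x : X)) (fun x : F => (x : X))).trace‖ₑ ≤ c) :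
    traceNorm M ≤ c := iSup_le fun F => iSup_le fun B => iSup_le fun hB => h F _ B hB

theorem traceNorm_add_le (M N : Op X) : traceNorm (M + N) ≤ traceNorm M + traceNorm N := by
  refine traceNorm_le fun F _ B hB => ?_
  rw [show (M + N).submatrix (fun x : F => (x : X)) (fun x : F => (x : X)) =
    M.submatrix (fun x : F => (x : X)) (fun x : F => (x : X)) +
    N.submatrix (fun x : F => (x : X)) (fun x : F => (x : X)) from rfl, Matrix.mul_add, Matrix.trace_add]
  exact (enorm_add_le _ _).trans (add_le_add (le_traceNorm M hB) (le_traceNorm N hB))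

theorem traceNorm_smul_le (c : ℂ) (M : Op X) : traceNorm (c • M) ≤ ‖c‖ₑ * traceNorm M := by
  refine traceNorm_le fun F _ B hB => ?_
  rw [show (c • M).submatrix (fun x : F => (x : X)) (fun x : F => (x : X)) =
    c • M.submatrix (fun x : F => (x : X)) (fun x : F => (x : X)) from rfl, Matrix.mul_smul, Matrix.trace_smul, enorm_smul]
  gcongr
  exact le_traceNorm M hB

theorem traceNorm_sub_le (M N : Op X) : traceNorm (M - N) ≤ traceNorm M + traceNorm N := by
  refine traceNorm_le fun F _ B hB => ?_
  rw [show (M - N).submatrix (fun x : F => (x : X)) (fun x : F => (x : X)) =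
    M.submatrix (fun x : F => (x : X)) (fun x : F => (x : X)) -
    N.submatrix (fun x : F => (x : X)) (fun x : F => (x : X)) from rfl, Matrix.mul_sub, Matrix.trace_sub]
  exact enorm_sub_le.trans (add_le_add (le_traceNorm M hB) (le_traceNorm N hB))

@[simp] theorem traceNorm_zero : traceNorm (0 : Op X) = 0 :=
  le_antisymm (traceNorm_le fun F _ B _ => by simp) bot_le

theorem traceNorm_sum_le {ι : Type*} (s : Finset ι) (f : ι → Op X) :
    traceNorm (∑ i ∈ s, f i) ≤ ∑ i ∈ s, traceNorm (f i) := by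
  classical
  induction s using Finset.induction_on with
  | empty => simp
  | insert i s hi ih =>
    rw [Finset.sum_insert hi, Finset.sum_insert hi]
    exact (traceNorm_add_le _ _).trans (add_le_add le_rfl ih)

theorem ofReal_trace_submatrix_le {M : Op X} (F : Finset X) (hM : M.PosSemidef) :
    ENNReal.ofReal (M.submatrix (fun x : F => (x : X)) (fun x : F => (x : X))).trace.re ≤
      posTrace M := by
  simp only [Matrix.trace, Matrix.diag, Matrix.submatrix_apply, Complex.re_sum]
  rw [Finset.sum_coe_sort F (fun x => (M x x).re),
    ENNReal.ofReal_sum_of_nonneg fun x _ => re_diag_nonneg hM x]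
  exact ENNReal.sum_le_tsum F

theorem traceNorm_le_posTrace {M : Op X} (hM : M.PosSemidef) : traceNorm M ≤ posTrace M := by
  refine traceNorm_le fun F _ B hB => ?_
  rw [← ofReal_norm]
  exact (ENNReal.ofReal_le_ofReal (norm_trace_mul_le hB (hM.submatrix _))).trans
    (ofReal_trace_submatrix_le F hM)

/-- A matrix unit is a contraction, and testing against it reads off an entry. -/
theorem enorm_apply_le_traceNorm (M : Op X) (x y : X) : ‖M x y‖ₑ ≤ traceNorm M := by
  classical
  let F : Finset X := {x, y}
  let x' : F := ⟨x, by simp [F]⟩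
  let y' : F := ⟨y, by simp [F]⟩
  have hB : (1 - (Matrix.single y' x' (1 : ℂ)).conjTranspose * Matrix.single y' x' 1).PosSemidef := by
    rw [Matrix.conjTranspose_single, Matrix.single_mul_single_same, ← Matrix.diagonal_one,
      star_one, mul_one, ← Matrix.diagonal_single, Matrix.diagonal_sub]
    refine Matrix.PosSemidef.diagonal fun i => ?_
    by_cases h : i = x'
    · subst h; simp
    · simp [Pi.single_eq_of_ne h]
  have := le_traceNorm M hB
  rwa [Matrix.trace_single_mul, one_smul] at this

theorem enorm_apply_le_posTrace {M : Op X} (hM : M.PosSemidef) (x y : X) :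
    ‖M x y‖ₑ ≤ posTrace M :=
  (enorm_apply_le_traceNorm M x y).trans (traceNorm_le_posTrace hM)

theorem eq_zero_of_posTrace_eq_zero {M : Op X} (hM : M.PosSemidef) (h : posTrace M = 0) :
    M = 0 := by
  ext x y
  simpa [h] using enorm_apply_le_posTrace hM x y

end TraceNorm

/-! ### Compressions to sets of basis vectors. -/

section Truncation

variable {X Y : Type}

open Classical in
/-- The compression of an operator to the span of a set of basis vectors. -/
noncomputable def trunc (S : Set X) (ρ : Op X) : Op X :=
  fun x y => if x ∈ S ∧ y ∈ S then ρ x y else 0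

theorem trunc_eq_weight (S : Set X) (ρ : Op X) : trunc S ρ = fun x y =>
    S.indicator (fun _ => (1 : ℂ)) x * ρ x y * star (S.indicator (fun _ => (1 : ℂ)) y) := by
  ext x y
  by_cases hx : x ∈ S <;> by_cases hy : y ∈ S <;> simp [trunc, hx, hy]

theorem posSemidef_trunc {ρ : Op X} (hρ : ρ.PosSemidef) (S : Set X) : (trunc S ρ).PosSemidef := by
  rw [trunc_eq_weight]
  exact posSemidef_weight hρ _

theorem posTrace_trunc (ρ : Op X) (S : Set X) :
    posTrace (trunc S ρ) = ∑' x : S, ENNReal.ofReal (ρ x x).re := by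
  rw [tsum_subtype S fun x => ENNReal.ofReal (ρ x x).re]
  refine tsum_congr fun x => ?_
  by_cases hx : x ∈ S <;> simp [trunc, hx]

theorem posTrace_trunc_le (ρ : Op X) (S : Set X) : posTrace (trunc S ρ) ≤ posTrace ρ := by
  rw [posTrace_trunc]
  exact ENNReal.tsum_comp_le_tsum_of_injective Subtype.val_injective
    fun x => ENNReal.ofReal (ρ x x).re

theorem IsPositiveTC.trunc {ρ : Op X} (hρ : IsPositiveTC ρ) (S : Set X) :
    IsPositiveTC (trunc S ρ) :=
  isPositiveTC_iff.2 ⟨posSemidef_trunc hρ.1 S,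
    ne_top_of_le_ne_top hρ.posTrace_ne_top (posTrace_trunc_le ρ S)⟩

theorem trunc_add (S : Set X) (ρ τ : Op X) : trunc S (ρ + τ) = trunc S ρ + trunc S τ := by
  ext x y
  by_cases h : x ∈ S ∧ y ∈ S <;> simp [trunc, h]

theorem trunc_smul (S : Set X) (c : ℂ) (ρ : Op X) : trunc S (c • ρ) = c • trunc S ρ := by
  ext x y
  by_cases h : x ∈ S ∧ y ∈ S <;> simp [trunc, h]

theorem tendsto_posTrace_trunc_compl {ρ : Op X} (hρ : IsPositiveTC ρ) :
    Tendsto (fun F : Finset X => posTrace (trunc (F : Set X)ᶜ ρ)) atTop (𝓝 0) := by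
  simp only [posTrace_trunc]
  exact ENNReal.tendsto_tsum_compl_atTop_zero hρ.posTrace_ne_top

/-- Truncating a positive operator changes it by a difference of two positive operators whose
traces are small if little of the trace is lost. -/
theorem exists_sub_trunc_eq {ρ : Op X} (hρ : IsPositiveTC ρ) (S : Set X) {ε : ℝ} (hε : 0 < ε) :
    ∃ U V : Op X, IsPositiveTC U ∧ IsPositiveTC V ∧ ρ - trunc S ρ = U - V ∧
      posTrace U + posTrace V ≤ ENNReal.ofReal (2 * ε ^ 2) * posTrace ρ +
        ENNReal.ofReal (2 * (ε⁻¹) ^ 2 + 1) * posTrace (trunc Sᶜ ρ) := by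
  classical
  -- With `P` the projection onto `S` and `Q = 1 - P`, conjugating `ρ` by `ε P + ε⁻¹ Q` leaves the
  -- cross terms `PρQ + QρP` unchanged and scales `PρP` and `QρQ` by `ε²` and `ε⁻²`. So the cross
  -- terms are `W - V`, where `W` and `V` have the same diagonal, hence the same trace.
  let w : X → ℂ := fun x => if x ∈ S then (ε : ℂ) else ((ε⁻¹ : ℝ) : ℂ)
  let W : Op X := fun x y => w x * ρ x y * star (w y)
  let V : Op X := ((ε ^ 2 : ℝ) : ℂ) • trunc S ρ + (((ε⁻¹) ^ 2 : ℝ) : ℂ) • trunc Sᶜ ρ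
  have h1 := hρ.trunc S
  have h2 := hρ.trunc Sᶜ
  have hV : IsPositiveTC V := (h1.smul (by positivity)).add (h2.smul (by positivity))
  have hW : W.PosSemidef := posSemidef_weight hρ.1 w
  have hWV : posTrace W = posTrace V := by
    refine tsum_congr fun x => ?_
    congr 2
    change w x * ρ x x * star (w x) = ((ε ^ 2 : ℝ) : ℂ) * trunc S ρ x x +
      (((ε⁻¹) ^ 2 : ℝ) : ℂ) * trunc Sᶜ ρ x x
    by_cases hx : x ∈ S <;> simp [w, trunc, hx] <;> ring
  have hW' : IsPositiveTC W := isPositiveTC_iff.2 ⟨hW, hWV ▸ hV.posTrace_ne_top⟩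
  have hε' : (ε : ℂ) ≠ 0 := by exact_mod_cast hε.ne'
  refine ⟨W + trunc Sᶜ ρ, V, hW'.add h2, hV, ?_, ?_⟩
  · ext x y
    change ρ x y - trunc S ρ x y = w x * ρ x y * star (w y) + trunc Sᶜ ρ x y -
      (((ε ^ 2 : ℝ) : ℂ) * trunc S ρ x y + (((ε⁻¹) ^ 2 : ℝ) : ℂ) * trunc Sᶜ ρ x y)
    by_cases hx : x ∈ S <;> by_cases hy : y ∈ S <;> simp [w, trunc, hx, hy] <;> field_simp <;>
      ring
  · rw [posTrace_add hW h2.1, hWV, posTrace_add (posSemidef_smul h1.1 (by positivity))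
      (posSemidef_smul h2.1 (by positivity)), posTrace_smul _ (by positivity),
      posTrace_smul _ (by positivity), ENNReal.ofReal_add (by positivity) (by positivity),
      ENNReal.ofReal_mul (by norm_num), ENNReal.ofReal_mul (by norm_num)]
    have := posTrace_trunc_le ρ S
    calc _ = 2 * ENNReal.ofReal (ε ^ 2) * posTrace (trunc S ρ) +
        (2 * ENNReal.ofReal (ε⁻¹ ^ 2) + 1) * posTrace (trunc Sᶜ ρ) := by ring
      _ ≤ _ := by
        simp only [ENNReal.ofReal_ofNat, ENNReal.ofReal_one]
        gcongr

end Truncation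

/-! ### Channels: extension to arbitrary ancillas and closure properties. -/

section Channels

variable {X Y Z : Type}

/-- Positivity is tested on finitely many points, which involve only finitely many ancilla indices;
so the ancillas `Fin m` suffice for every `R`. -/
theorem posSemidef_onRight_of_fin {R : Type} {Φ : Op X → Op Y} {ρ : Op (R × X)}
    (h : ∀ (m : ℕ) (π : Fin m → R),
      (onRight (Fin m) Φ (ρ.submatrix (Prod.map π id) (Prod.map π id))).PosSemidef) :
    (onRight R Φ ρ).PosSemidef :=
  posSemidef_of_fin fun m u => (h m fun i => (u i).1).submatrix fun i => (i, (u i).2)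

/-- `π` may repeat indices, so the trace can grow, but it is at most `m` times that of `ρ`. -/
theorem IsPositiveTC.submatrix_prodMap {R : Type} {ρ : Op (R × X)} (hρ : IsPositiveTC ρ)
    {m : ℕ} (π : Fin m → R) :
    IsPositiveTC (ρ.submatrix (Prod.map π id) (Prod.map π id)) := by
  refine isPositiveTC_iff.2 ⟨hρ.1.submatrix _, ?_⟩
  simp only [posTrace, ENNReal.tsum_prod', Matrix.submatrix_apply, Prod.map, id, tsum_fintype]
  refine ENNReal.sum_ne_top.2 fun i _ => ne_top_of_le_ne_top hρ.posTrace_ne_top ?_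
  exact posTrace_submatrix_le ρ (f := fun x => (π i, x)) (Prod.mk_right_injective _)

/-- It is enough to check the laws of a channel on positive operators. -/
theorem isChannel_of_positive {Φ : Op X → Op Y}
    (map_add : ∀ ρ τ, IsTraceClass ρ → IsTraceClass τ → Φ (ρ + τ) = Φ ρ + Φ τ)
    (map_smul : ∀ (c : ℂ) (ρ), IsTraceClass ρ → Φ (c • ρ) = c • Φ ρ)
    (cp : ∀ (m : ℕ) (ρ : Op (Fin m × X)), IsPositiveTC ρ → (onRight (Fin m) Φ ρ).PosSemidef)
    (tp : ∀ ρ, IsPositiveTC ρ → posTrace (Φ ρ) = posTrace ρ) : IsChannel Φ := by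
  have pos : ∀ ρ, IsPositiveTC ρ → IsPositiveTC (Φ ρ) := by
    intro ρ hρ
    refine isPositiveTC_iff.2 ⟨?_, by rw [tp ρ hρ]; exact hρ.posTrace_ne_top⟩
    exact (cp 1 (ρ.submatrix Prod.snd Prod.snd)
      (hρ.submatrix fun x y h => Prod.ext (Subsingleton.elim _ _) h)).submatrix fun y => (0, y)
  have tc : ∀ ρ, IsTraceClass ρ → IsTraceClass (Φ ρ) := by
    intro ρ hρ
    refine hρ.induction (P := fun ρ => IsTraceClass (Φ ρ)) (fun ρ h => (pos ρ h).isTraceClass)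
      (fun ρ τ h h' i i' => ?_) (fun c ρ h i => ?_)
    · rw [map_add ρ τ h h']; exact i.add i'
    · rw [map_smul c ρ h]; exact i.smul c
  refine ⟨map_add, map_smul, tc, cp, fun ρ hρ => ?_⟩
  refine hρ.induction (P := fun ρ => ∑' y, Φ ρ y y = ∑' x, ρ x x)
    (fun ρ h => ?_) (fun ρ τ h h' i i' => ?_) (fun c ρ h i => ?_)
  · rw [(pos ρ h).hasSum.tsum_eq, h.hasSum.tsum_eq, tp ρ h]
  · rw [map_add ρ τ h h']
    simp only [Matrix.add_apply]
    rw [(tc ρ h).summable.tsum_add (tc τ h').summable, h.summable.tsum_add h'.summable, i, i']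
  · rw [map_smul c ρ h]
    simp only [Matrix.smul_apply]
    rw [(tc ρ h).summable.tsum_const_smul c, h.summable.tsum_const_smul c, i]

namespace IsChannel

variable {Φ : Op X → Op Y}

theorem map_zero (h : IsChannel Φ) : Φ 0 = 0 := by
  simpa using h.map_smul 0 0 isTraceClass_zero

theorem map_sub (h : IsChannel Φ) {ρ τ : Op X} (hρ : IsTraceClass ρ) (hτ : IsTraceClass τ) :
    Φ (ρ - τ) = Φ ρ - Φ τ := by
  have := h.map_add ρ ((-1 : ℂ) • τ) hρ (hτ.smul _)
  rw [h.map_smul _ _ hτ] at this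
  simpa [sub_eq_add_neg] using this

theorem map_sum (h : IsChannel Φ) {ι : Type*} (s : Finset ι) (f : ι → Op X)
    (hf : ∀ i ∈ s, IsTraceClass (f i)) : Φ (∑ i ∈ s, f i) = ∑ i ∈ s, Φ (f i) := by
  classical
  induction s using Finset.induction_on with
  | empty => simpa using h.map_zero
  | insert i s hi ih =>
    rw [Finset.sum_insert hi, Finset.sum_insert hi, h.map_add _ _ (hf i (by simp))
      (isTraceClass_sum fun j hj => hf j (by simp [hj])), ih fun j hj => hf j (by simp [hj])]

theorem posSemidef_onRight (h : IsChannel Φ) {R : Type} {ρ : Op (R × X)} (hρ : IsPositiveTC ρ) :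
    (onRight R Φ ρ).PosSemidef :=
  posSemidef_onRight_of_fin fun m π => h.completelyPositive m _ (hρ.submatrix_prodMap π)

theorem isPositiveTC (h : IsChannel Φ) {ρ : Op X} (hρ : IsPositiveTC ρ) : IsPositiveTC (Φ ρ) := by
  refine IsPositiveTC.of_isTraceClass ?_ (h.traceClass ρ hρ.isTraceClass)
  exact (h.posSemidef_onRight (R := Unit) (ρ := ρ.submatrix Prod.snd Prod.snd)
    (hρ.submatrix fun x y h => Prod.ext (Subsingleton.elim _ _) h)).submatrix fun y => ((), y)

theorem posTrace_eq (h : IsChannel Φ) {ρ : Op X} (hρ : IsPositiveTC ρ) :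
    posTrace (Φ ρ) = posTrace ρ := by
  have := h.tracePreserving ρ hρ.isTraceClass
  rw [(h.isPositiveTC hρ).hasSum.tsum_eq, hρ.hasSum.tsum_eq] at this
  exact (ENNReal.toReal_eq_toReal_iff' (h.isPositiveTC hρ).posTrace_ne_top
    hρ.posTrace_ne_top).1 (by exact_mod_cast this)

theorem isState (h : IsChannel Φ) {ρ : Op X} (hρ : IsState ρ) : IsState (Φ ρ) :=
  isState_iff.2 ⟨(h.isPositiveTC hρ.isPositiveTC).1, by
    rw [h.posTrace_eq hρ.isPositiveTC, (isState_iff.1 hρ).2]⟩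

end IsChannel

/-- A positive operator is zero or a multiple of a state. -/
theorem IsPositiveTC.eq_smul_isState {ρ : Op X} (hρ : IsPositiveTC ρ) :
    ρ = 0 ∨ ∃ τ, IsState τ ∧ ρ = ((posTrace ρ).toReal : ℂ) • τ := by
  by_cases h0 : posTrace ρ = 0
  · exact Or.inl (eq_zero_of_posTrace_eq_zero hρ.1 h0)
  have ht : 0 < (posTrace ρ).toReal := ENNReal.toReal_pos h0 hρ.posTrace_ne_top
  refine Or.inr ⟨(((posTrace ρ).toReal⁻¹ : ℝ) : ℂ) • ρ, ?_, ?_⟩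
  · refine isState_iff.2 ⟨(hρ.smul (inv_nonneg.2 ht.le)).1, ?_⟩
    rw [posTrace_smul _ (inv_nonneg.2 ht.le), ENNReal.ofReal_inv_of_pos ht,
      ENNReal.ofReal_toReal hρ.posTrace_ne_top, ENNReal.inv_mul_cancel h0 hρ.posTrace_ne_top]
  · rw [smul_smul, ← Complex.ofReal_mul, mul_inv_cancel₀ ht.ne', Complex.ofReal_one, one_smul]

/-- Channels that agree on the states agree on all trace-class operators. -/
theorem IsChannel.eq_of_isState {Φ Ψ : Op X → Op Y} (hΦ : IsChannel Φ) (hΨ : IsChannel Ψ)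
    (h : ∀ ρ, IsState ρ → Φ ρ = Ψ ρ) {ρ : Op X} (hρ : IsTraceClass ρ) : Φ ρ = Ψ ρ := by
  refine hρ.induction (P := fun ρ => Φ ρ = Ψ ρ) (fun ρ hρ => ?_) (fun ρ τ hρ hτ i i' => ?_)
    fun c ρ hρ i => ?_
  · obtain h0 | ⟨τ, hτ, e⟩ := hρ.eq_smul_isState
    · rw [h0, hΦ.map_zero, hΨ.map_zero]
    · rw [e, hΦ.map_smul _ _ hτ.isTraceClass, hΨ.map_smul _ _ hτ.isTraceClass, h τ hτ]
  · rw [hΦ.map_add _ _ hρ hτ, hΨ.map_add _ _ hρ hτ, i, i']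
  · rw [hΦ.map_smul _ _ hρ, hΨ.map_smul _ _ hρ, i]

theorem isChannel_id : IsChannel (fun ρ : Op X => ρ) :=
  isChannel_of_positive (fun _ _ _ _ => rfl) (fun _ _ _ => rfl) (fun _ _ h => h.1) fun _ _ => rfl

theorem IsChannel.comp {Φ : Op X → Op Y} {Ψ : Op Y → Op Z} (hΨ : IsChannel Ψ)
    (hΦ : IsChannel Φ) : IsChannel fun ρ => Ψ (Φ ρ) := by
  refine isChannel_of_positive (fun ρ τ h h' => ?_) (fun c ρ h => ?_) (fun m ρ h => ?_)
    fun ρ h => ?_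
  · rw [hΦ.map_add ρ τ h h', hΨ.map_add _ _ (hΦ.traceClass ρ h) (hΦ.traceClass τ h')]
  · rw [hΦ.map_smul c ρ h, hΨ.map_smul _ _ (hΦ.traceClass ρ h)]
  · refine hΨ.completelyPositive m (onRight (Fin m) Φ ρ) (isPositiveTC_iff.2
      ⟨hΦ.completelyPositive m ρ h, ?_⟩)
    simp only [posTrace, ENNReal.tsum_prod', tsum_fintype]
    refine ENNReal.sum_ne_top.2 fun i _ => ?_
    exact (hΦ.isPositiveTC (h.submatrix (f := fun x => (i, x))
      (Prod.mk_right_injective _))).posTrace_ne_top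
  · rw [hΨ.posTrace_eq (hΦ.isPositiveTC h), hΦ.posTrace_eq h]

theorem isChannel_reindex (e : Y ≃ X) : IsChannel fun ρ : Op X => ρ.submatrix e e :=
  isChannel_of_positive (fun _ _ _ _ => rfl) (fun _ _ _ => rfl)
    (fun _ _ h => h.1.submatrix (Prod.map id e)) fun ρ _ => posTrace_submatrix_equiv ρ e

theorem isChannel_tensor {τ : Op Y} (hτ : IsState τ) : IsChannel fun ρ : Op X => tensor ρ τ := by
  refine isChannel_of_positive (fun ρ ρ' _ _ => ?_) (fun c ρ _ => ?_) (fun m ρ h => ?_)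
    fun ρ h => ?_
  · ext p q; simp [tensor, add_mul]
  · ext p q; simp [tensor, mul_assoc]
  · exact (posSemidef_tensor h.1 hτ.1).submatrix fun p : Fin m × (X × Y) => ((p.1, p.2.1), p.2.2)
  · rw [posTrace_tensor h.1 hτ.1, (isState_iff.1 hτ).2, mul_one]

/-- Linearity holds because every block of a trace-class operator is trace class. Complete
positivity follows by merging the two ancillas into `Fin m × R`, and the trace is the sum over the
diagonal blocks. -/
theorem IsChannel.onLeft {Φ : Op X → Op Y} (h : IsChannel Φ) (R : Type) :
    IsChannel (onLeft R Φ) := by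
  have blk : ∀ {ρ : Op (X × R)}, IsTraceClass ρ → ∀ r r',
      IsTraceClass (fun x x' => ρ (x, r) (x', r') : Op X) := fun hρ r r' =>
    hρ.block (Prod.mk_left_injective r) (Prod.mk_left_injective r')
  refine isChannel_of_positive (fun ρ τ hρ hτ => ?_) (fun c ρ hρ => ?_) (fun m ρ hρ => ?_)
    fun ρ hρ => ?_
  · ext p q
    exact congrFun (congrFun (h.map_add _ _ (blk hρ p.2 q.2) (blk hτ p.2 q.2)) p.1) q.1
  · ext p q
    exact congrFun (congrFun (h.map_smul c _ (blk hρ p.2 q.2)) p.1) q.1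
  · exact (h.posSemidef_onRight (R := Fin m × R)
      (ρ := ρ.submatrix (fun p => (p.1.1, (p.2, p.1.2))) fun p => (p.1.1, (p.2, p.1.2)))
      (hρ.submatrix fun p q => by simp +contextual [Prod.ext_iff])).submatrix
      fun p : Fin m × (Y × R) => ((p.1, p.2.2), p.2.1)
  · rw [posTrace_prod, posTrace_prod]
    exact tsum_congr fun r => h.posTrace_eq (hρ.submatrix (Prod.mk_left_injective r))

theorem IsChannel.onRight {Φ : Op X → Op Y} (h : IsChannel Φ) (R : Type) :
    IsChannel (onRight R Φ) :=
  (isChannel_reindex (Equiv.prodComm R Y)).comp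
    ((h.onLeft R).comp (isChannel_reindex (Equiv.prodComm X R)))

end Channels

/-! ### Approximation by finite truncations and contractivity of channels. -/

section Limits

variable {X Y : Type} {Φ : Op X → Op Y}

theorem IsChannel.traceNorm_sub_trunc_le (h : IsChannel Φ) {ρ : Op X} (hρ : IsPositiveTC ρ)
    (S : Set X) {ε : ℝ} (hε : 0 < ε) : traceNorm (Φ ρ - Φ (trunc S ρ)) ≤
      ENNReal.ofReal (2 * ε ^ 2) * posTrace ρ +
        ENNReal.ofReal (2 * (ε⁻¹) ^ 2 + 1) * posTrace (trunc Sᶜ ρ) := by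
  obtain ⟨U, V, hU, hV, e, hle⟩ := exists_sub_trunc_eq hρ S hε
  rw [← h.map_sub hρ.isTraceClass (hρ.trunc S).isTraceClass, e,
    h.map_sub hU.isTraceClass hV.isTraceClass]
  refine (traceNorm_sub_le _ _).trans (le_trans (add_le_add ?_ ?_) hle)
  · exact (traceNorm_le_posTrace (h.isPositiveTC hU).1).trans_eq (h.posTrace_eq hU)
  · exact (traceNorm_le_posTrace (h.isPositiveTC hV).1).trans_eq (h.posTrace_eq hV)

/-- The modulus of continuity of truncations on the states. -/
theorem exists_traceNorm_sub_trunc_le {δ : ℝ≥0∞} (hδ : 0 < δ) {t : ℝ≥0∞} (ht : t ≠ ⊤) :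
    ∃ η : ℝ≥0∞, 0 < η ∧ ∀ {X Y : Type} {Φ : Op X → Op Y}, IsChannel Φ →
      ∀ ρ : Op X, IsPositiveTC ρ → posTrace ρ ≤ t → ∀ S : Set X, posTrace (trunc Sᶜ ρ) ≤ η →
        traceNorm (Φ ρ - Φ (trunc S ρ)) ≤ δ := by
  -- `ε` is fixed first to control the bulk term, then `η` absorbs the large constant `2 ε⁻² + 1` in
  -- front of the tail. Neither depends on the spaces, the channel or `ρ`.
  obtain ⟨ε, hε, h1⟩ : ∃ ε : ℝ, 0 < ε ∧ ENNReal.ofReal (2 * ε ^ 2) * t ≤ δ / 2 := by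
    have : Tendsto (fun ε : ℝ => ENNReal.ofReal (2 * ε ^ 2) * t) (𝓝[>] 0) (𝓝 0) := by
      have h0 : Tendsto (fun ε : ℝ => ENNReal.ofReal (2 * ε ^ 2)) (𝓝[>] 0) (𝓝 0) := by
        have : Continuous fun ε : ℝ => ENNReal.ofReal (2 * ε ^ 2) :=
          ENNReal.continuous_ofReal.comp (by fun_prop)
        simpa using (this.tendsto 0).mono_left nhdsWithin_le_nhds
      simpa using ENNReal.Tendsto.mul_const h0 (Or.inr ht)
    have h2 : 0 < δ / 2 := ENNReal.div_pos hδ.ne' (by simp)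
    obtain ⟨ε, h, h'⟩ := ((ENNReal.tendsto_nhds_zero.1 this _ h2).and
      self_mem_nhdsWithin).exists
    exact ⟨ε, h', h⟩
  have hc : ENNReal.ofReal (2 * (ε⁻¹) ^ 2 + 1) ≠ 0 := by
    have : 0 < 2 * (ε⁻¹) ^ 2 + 1 := by positivity
    simpa using this
  refine ⟨δ / 2 / ENNReal.ofReal (2 * (ε⁻¹) ^ 2 + 1),
    ENNReal.div_pos (ENNReal.div_pos hδ.ne' (by simp)).ne' ENNReal.ofReal_ne_top, ?_⟩
  intro X Y Φ h ρ hρ hρt S hS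
  refine (h.traceNorm_sub_trunc_le hρ S hε).trans ?_
  calc _ ≤ δ / 2 + δ / 2 := by
        gcongr
        · exact (by gcongr : _ ≤ _).trans h1
        · rw [mul_comm]
          exact (ENNReal.le_div_iff_mul_le (Or.inl hc) (Or.inl ENNReal.ofReal_ne_top)).1 hS
    _ = δ := ENNReal.add_halves δ

theorem IsChannel.tendsto_traceNorm_trunc (h : IsChannel Φ) {ρ : Op X} (hρ : IsPositiveTC ρ) :
    Tendsto (fun F : Finset X => traceNorm (Φ ρ - Φ (trunc F ρ))) atTop (𝓝 0) := by
  refine ENNReal.tendsto_nhds_zero.2 fun δ hδ => ?_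
  obtain ⟨η, hη, H⟩ := exists_traceNorm_sub_trunc_le hδ hρ.posTrace_ne_top
  filter_upwards [ENNReal.tendsto_nhds_zero.1 (tendsto_posTrace_trunc_compl hρ) η hη] with F hF
  exact H h ρ hρ le_rfl _ hF

theorem trunc_finset_eq_sum [DecidableEq X] (F : Finset X) (ρ : Op X) :
    trunc F ρ = ∑ a ∈ F, ∑ b ∈ F, ρ a b • (Matrix.single a b (1 : ℂ) : Op X) := by
  ext x y
  simp only [Matrix.sum_apply, Matrix.smul_apply, Matrix.single_apply, smul_eq_mul, mul_ite,
    mul_one, mul_zero, trunc, Finset.mem_coe, ite_and]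
  simp

theorem isTraceClass_trunc (F : Finset X) (ρ : Op X) : IsTraceClass (trunc F ρ) := by
  classical
  rw [trunc_finset_eq_sum]
  exact isTraceClass_sum fun a _ => isTraceClass_sum fun b _ => (isTraceClass_single a b).smul _

theorem IsChannel.apply_trunc [DecidableEq X] (h : IsChannel Φ) (F : Finset X) (ρ : Op X) (x y : Y) :
    Φ (trunc F ρ) x y = ∑ a ∈ F, ∑ b ∈ F, ρ a b * Φ (Matrix.single a b 1) x y := by
  have e := h.map_sum F (fun a => ∑ b ∈ F, ρ a b • (Matrix.single a b (1 : ℂ) : Op X))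
    fun a _ => isTraceClass_sum fun b _ => (isTraceClass_single a b).smul _
  rw [trunc_finset_eq_sum, e, Matrix.sum_apply]
  refine Finset.sum_congr rfl fun a _ => ?_
  have e := h.map_sum F (fun b => ρ a b • (Matrix.single a b (1 : ℂ) : Op X))
    fun b _ => (isTraceClass_single a b).smul _
  rw [e, Matrix.sum_apply]
  refine Finset.sum_congr rfl fun b _ => ?_
  rw [h.map_smul _ _ (isTraceClass_single a b), Matrix.smul_apply, smul_eq_mul]

/-- A channel is thus determined by its values on matrix units. This entrywise continuity is what
gives measurability of parametrized families and the exchange of channels with integrals. -/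
theorem IsChannel.tendsto_apply_trunc (h : IsChannel Φ) {ρ : Op X} (hρ : IsTraceClass ρ) (x y : Y) :
    Tendsto (fun F : Finset X => Φ (trunc F ρ) x y) atTop (𝓝 (Φ ρ x y)) := by
  refine hρ.induction (P := fun ρ => Tendsto (fun F : Finset X => Φ (trunc F ρ) x y) atTop
    (𝓝 (Φ ρ x y))) (fun ρ hρ => ?_) (fun ρ τ hρ hτ i i' => ?_) fun c ρ hρ i => ?_
  · rw [tendsto_iff_edist_tendsto_0]
    refine tendsto_of_tendsto_of_tendsto_of_le_of_le tendsto_const_nhds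
      (h.tendsto_traceNorm_trunc hρ) (fun _ => bot_le) fun F => ?_
    dsimp only
    rw [edist_comm, edist_eq_enorm_sub]
    exact enorm_apply_le_traceNorm (Φ ρ - Φ (trunc F ρ)) x y
  · rw [h.map_add ρ τ hρ hτ]
    refine (i.add i').congr fun F => ?_
    rw [trunc_add, h.map_add _ _ (isTraceClass_trunc F ρ) (isTraceClass_trunc F τ),
      Matrix.add_apply]
  · rw [h.map_smul c ρ hρ]
    refine (i.const_mul c).congr fun F => ?_
    rw [trunc_smul, h.map_smul _ _ (isTraceClass_trunc F ρ), Matrix.smul_apply, smul_eq_mul]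

/-- The extension by zero of an operator on finitely many basis vectors. -/
noncomputable def extendZero (F : Finset X) [DecidableEq X] (H : Matrix F F ℂ) : Op X :=
  fun x y => ∑ a : F, ∑ b : F, (if x = (a : X) then 1 else 0) * H a b *
    star (if y = (b : X) then (1 : ℂ) else 0)

theorem extendZero_apply [DecidableEq X] (F : Finset X) (H : Matrix F F ℂ) (a b : F) :
    extendZero F H a b = H a b := by
  simp [extendZero, apply_ite (starRingEnd ℂ)]

theorem extendZero_apply_of_notMem [DecidableEq X] (F : Finset X) (H : Matrix F F ℂ) {x y : X}
    (h : x ∉ F ∨ y ∉ F) : extendZero F H x y = 0 := by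
  refine Finset.sum_eq_zero fun a _ => Finset.sum_eq_zero fun b _ => ?_
  rcases h with h | h
  · have ha : x ≠ a := fun e => h (e ▸ a.2)
    rw [if_neg ha, zero_mul, zero_mul]
  · have hb : y ≠ b := fun e => h (e ▸ b.2)
    rw [if_neg hb, star_zero, mul_zero]

theorem isPositiveTC_extendZero [DecidableEq X] {F : Finset X} {H : Matrix F F ℂ}
    (hH : H.PosSemidef) : IsPositiveTC (extendZero F H) ∧
      posTrace (extendZero F H) = ENNReal.ofReal H.trace.re := by
  have h1 : posTrace (extendZero F H) = ENNReal.ofReal H.trace.re := by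
    rw [posTrace, tsum_eq_sum (s := F) fun x hx => by
      rw [extendZero_apply_of_notMem F H (Or.inl hx)]; simp, ← Finset.sum_coe_sort]
    simp only [extendZero_apply, Matrix.trace, Matrix.diag, Complex.re_sum]
    rw [ENNReal.ofReal_sum_of_nonneg fun x _ => (Complex.le_def.1 hH.diag_nonneg).1]
  refine ⟨isPositiveTC_iff.2 ⟨?_, h1 ▸ ENNReal.ofReal_ne_top⟩, h1⟩
  exact posSemidef_conj hH fun (x : X) (a : F) => if x = (a : X) then 1 else 0

theorem trunc_eq_extendZero [DecidableEq X] (F : Finset X) (M : Op X) :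
    trunc F M = extendZero F (M.submatrix (fun x : F => (x : X)) (fun x : F => (x : X))) := by
  ext x y
  by_cases h : x ∈ F ∧ y ∈ F
  · have := extendZero_apply F (M.submatrix (fun x : F => (x : X)) (fun x : F => (x : X)))
      ⟨x, h.1⟩ ⟨y, h.2⟩
    rw [this]
    simp [trunc, h]
  · rw [extendZero_apply_of_notMem _ _ (by tauto)]
    simp [trunc, h]

/-- Channels do not increase the trace norm of Hermitian operators. -/
theorem IsChannel.traceNorm_sub_le (h : IsChannel Φ) {ρ τ : Op X} (hρ : IsPositiveTC ρ)
    (hτ : IsPositiveTC τ) : traceNorm (Φ ρ - Φ τ) ≤ traceNorm (ρ - τ) := by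
  classical
  refine traceNorm_le fun F _ B hB => ?_
  set M : Op X := ρ - τ with hM
  have hMtc : IsTraceClass M := hρ.isTraceClass.sub hτ.isTraceClass
  have hMh : M.IsHermitian := hρ.1.1.sub hτ.1.1
  rw [← h.map_sub hρ.isTraceClass hτ.isTraceClass, ← hM]
  -- The test functional sees finitely many entries of `Φ N`, so entrywise convergence of
  -- truncations suffices to reduce to a finite corner of `M`.
  let f : Op X → ℂ := fun N =>
    (B * (Φ N).submatrix (fun x : F => (x : Y)) (fun x : F => (x : Y))).trace
  have hlim : Tendsto (fun G : Finset X => f (trunc G M)) atTop (𝓝 (f M)) := by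
    simp only [f, Matrix.trace, Matrix.diag, Matrix.mul_apply, Matrix.submatrix_apply]
    exact tendsto_finsetSum _ fun i _ => tendsto_finsetSum _ fun j _ =>
      (h.tendsto_apply_trunc hMtc _ _).const_mul _
  refine le_of_tendsto hlim.enorm (Eventually.of_forall fun G => ?_)
  -- The Hermitian corner splits as `P - N`, and the contraction `S`, which is admissible in
  -- `traceNorm M`, attains `tr P + tr N`.
  obtain ⟨P, N, S, hP, hN, hS, e, e'⟩ := exists_sign_decomposition
    (hMh.submatrix fun x : G => (x : X))
  obtain ⟨hP1, hP2⟩ := isPositiveTC_extendZero hP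
  obtain ⟨hN1, hN2⟩ := isPositiveTC_extendZero hN
  have hf : ∀ {N : Op X}, IsPositiveTC N → ‖f N‖ₑ ≤ posTrace N := by
    intro N hN
    rw [← h.posTrace_eq hN]
    exact (le_traceNorm _ hB).trans (traceNorm_le_posTrace (h.isPositiveTC hN).1)
  have hsub : trunc G M = extendZero G P - extendZero G N := by
    rw [trunc_eq_extendZero, e]
    ext x y
    simp only [extendZero, Matrix.sub_apply, mul_sub, sub_mul, Finset.sum_sub_distrib]
  have hfsub : f (trunc G M) = f (extendZero G P) - f (extendZero G N) := by
    have : (Φ (trunc G M)) = Φ (extendZero G P) - Φ (extendZero G N) := by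
      rw [hsub, h.map_sub hP1.isTraceClass hN1.isTraceClass]
    simp only [f, this, ← Matrix.trace_sub, ← Matrix.mul_sub]
    rfl
  calc ‖f (trunc G M)‖ₑ ≤ posTrace (extendZero G P) + posTrace (extendZero G N) := by
        rw [hfsub]
        exact enorm_sub_le.trans (add_le_add (hf hP1) (hf hN1))
    _ = ENNReal.ofReal (P.trace + N.trace).re := by
        rw [hP2, hN2, Complex.add_re, ENNReal.ofReal_add
          (Complex.le_def.1 hP.trace_nonneg).1 (Complex.le_def.1 hN.trace_nonneg).1]
    _ ≤ ‖P.trace + N.trace‖ₑ := by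
        rw [← ofReal_norm]
        exact ENNReal.ofReal_le_ofReal (Complex.re_le_norm _)
    _ ≤ traceNorm M := by
        rw [← e']
        exact le_traceNorm M hS

end Limits

/-! ### Instruments acting on part of a larger system. -/

section Instruments

variable {K : Type} [MeasurableSpace K] {ν : Measure K} {X Y X' Y' : Type} {J : K → Op X → Op Y}

/-- A measurable family of positive operators of finite total trace. -/
structure IsDensityFamily (ν : Measure K) (ω : K → Op X) : Prop where
  aemeasurable : ∀ x y, AEMeasurable (fun k => ω k x y) ν
  pos : ∀ᵐ k ∂ν, IsPositiveTC (ω k)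
  lintegral_ne_top : ∫⁻ k, posTrace (ω k) ∂ν ≠ ⊤

theorem aemeasurable_posTrace [Countable X] {ω : K → Op X}
    (h : ∀ x y, AEMeasurable (fun k => ω k x y) ν) : AEMeasurable (fun k => posTrace (ω k)) ν :=
  AEMeasurable.tsum fun x => (Complex.measurable_re.comp_aemeasurable (h x x)).ennreal_ofReal

theorem IsDensityFamily.of_posSemidef [Countable X] {ω : K → Op X}
    (h : ∀ x y, AEMeasurable (fun k => ω k x y) ν) (h' : ∀ᵐ k ∂ν, (ω k).PosSemidef)
    (ht : ∫⁻ k, posTrace (ω k) ∂ν ≠ ⊤) : IsDensityFamily ν ω := by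
  refine ⟨h, ?_, ht⟩
  filter_upwards [h', ae_lt_top' (aemeasurable_posTrace h) ht] with k hk hk'
  exact isPositiveTC_iff.2 ⟨hk, hk'.ne⟩

theorem IsInstrument.aemeasurable_onLeft (hJ : IsInstrument ν J) {R : Type} {ρ : Op (X × R)}
    (hρ : IsTraceClass ρ) (p q : Y × R) :
    AEMeasurable (fun k => Stretching.onLeft R (J k) ρ p q) ν :=
  hJ.aemeasurable _ (hρ.block (Prod.mk_left_injective p.2) (Prod.mk_left_injective q.2)) _ _

/-- Each input has its own exceptional null set. Countability of `R` leaves only countably many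
finite families `π`, so the null sets can be united. -/
theorem IsInstrument.posSemidef_onLeft (hJ : IsInstrument ν J) {R : Type} [Countable R]
    {ρ : Op (X × R)} (hρ : IsPositiveTC ρ) :
    ∀ᵐ k ∂ν, (Stretching.onLeft R (J k) ρ).PosSemidef := by
  have hρ' : IsPositiveTC (ρ.submatrix Prod.swap Prod.swap) := hρ.submatrix Prod.swap_injective
  have : ∀ᵐ k ∂ν, ∀ (m : ℕ) (π : Fin m → R), (onRight (Fin m) (J k)
      ((ρ.submatrix Prod.swap Prod.swap).submatrix (Prod.map π id) (Prod.map π id))).PosSemidef :=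
    ae_all_iff.2 fun m => ae_all_iff.2 fun π =>
      hJ.completelyPositive m _ (hρ'.submatrix_prodMap π)
  filter_upwards [this] with k hk
  exact (posSemidef_onRight_of_fin hk).submatrix Prod.swap

theorem IsInstrument.lintegral_posTrace_onLeft (hJ : IsInstrument ν J) {R : Type} [Countable R]
    [Countable Y] {ρ : Op (X × R)} (hρ : IsPositiveTC ρ) :
    ∫⁻ k, posTrace (Stretching.onLeft R (J k) ρ) ∂ν = posTrace ρ := by
  simp only [posTrace_prod (Stretching.onLeft R (J _) ρ)]
  rw [posTrace_prod, lintegral_tsum]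
  · exact tsum_congr fun r => hJ.total _ (hρ.submatrix (Prod.mk_left_injective r))
  · exact fun r => aemeasurable_posTrace fun y y' =>
      hJ.aemeasurable _ (hρ.submatrix (Prod.mk_left_injective r)).isTraceClass y y'

theorem IsInstrument.isDensityFamily_onLeft (hJ : IsInstrument ν J) {R : Type} [Countable R]
    [Countable Y] {ρ : Op (X × R)} (hρ : IsPositiveTC ρ) :
    IsDensityFamily ν fun k => Stretching.onLeft R (J k) ρ :=
  .of_posSemidef (hJ.aemeasurable_onLeft hρ.isTraceClass) (hJ.posSemidef_onLeft hρ)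
    (by rw [hJ.lintegral_posTrace_onLeft hρ]; exact hρ.posTrace_ne_top)

theorem IsInstrument.isDensityFamily (hJ : IsInstrument ν J) [Countable Y] {ρ : Op X}
    (hρ : IsPositiveTC ρ) : IsDensityFamily ν fun k => J k ρ := by
  refine .of_posSemidef (hJ.aemeasurable ρ hρ.isTraceClass) ?_
    ((hJ.total ρ hρ).trans_ne hρ.posTrace_ne_top)
  filter_upwards [hJ.posSemidef_onLeft (R := Unit) (ρ := ρ.submatrix Prod.fst Prod.fst)
    (hρ.submatrix fun x y h => Prod.ext h (Subsingleton.elim _ _))] with k hk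
  exact hk.submatrix fun y => (y, ())

theorem IsInstrument.reindex (hJ : IsInstrument ν J) (e : X ≃ X') (f : Y' ≃ Y) :
    IsInstrument ν fun k (ρ : Op X') => (J k (ρ.submatrix e e)).submatrix f f where
  aemeasurable ρ hρ y y' := hJ.aemeasurable _ (hρ.submatrix e.injective) _ _
  map_add ρ τ hρ hτ := by
    filter_upwards [hJ.map_add _ _ (hρ.submatrix e.injective) (hτ.submatrix e.injective)] with k hk
    exact congrArg (fun M : Op Y => M.submatrix f f) hk
  map_smul c ρ hρ := by
    filter_upwards [hJ.map_smul c _ (hρ.submatrix e.injective)] with k hk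
    exact congrArg (fun M : Op Y => M.submatrix f f) hk
  traceClass ρ hρ := by
    filter_upwards [hJ.traceClass _ (hρ.submatrix e.injective)] with k hk
    exact hk.submatrix f.injective
  completelyPositive m ρ hρ := by
    filter_upwards [hJ.completelyPositive m (ρ.submatrix (Prod.map id e) (Prod.map id e))
      (hρ.submatrix (Function.injective_id.prodMap e.injective))] with k hk
    exact hk.submatrix (Prod.map id f)
  total ρ hρ := by
    have h1 := hJ.total _ (hρ.submatrix e.injective)
    have h2 := posTrace_submatrix_equiv ρ e
    rw [show ∑' x, ENNReal.ofReal (ρ x x).re = posTrace ρ from rfl, ← h2]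
    refine Eq.trans (lintegral_congr fun k => ?_) h1
    exact posTrace_submatrix_equiv (J k (ρ.submatrix e e)) f

/-- An input has countably many blocks, so the almost-everywhere laws hold on all of them
simultaneously. -/
theorem IsInstrument.onLeft (hJ : IsInstrument ν J) (R : Type) [Countable R] [Countable Y] :
    IsInstrument ν fun k => onLeft R (J k) := by
  have blk : ∀ {ρ : Op (X × R)}, IsTraceClass ρ → ∀ r r',
      IsTraceClass (fun x x' => ρ (x, r) (x', r') : Op X) := fun hρ r r' =>
    hρ.block (Prod.mk_left_injective r) (Prod.mk_left_injective r')
  have add : ∀ ρ τ : Op (X × R), IsTraceClass ρ → IsTraceClass τ → ∀ᵐ k ∂ν,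
      Stretching.onLeft R (J k) (ρ + τ) =
        Stretching.onLeft R (J k) ρ + Stretching.onLeft R (J k) τ := by
    intro ρ τ hρ hτ
    filter_upwards [ae_all_iff.2 fun r => ae_all_iff.2 fun r' =>
      hJ.map_add _ _ (blk hρ r r') (blk hτ r r')] with k hk
    ext p q
    exact congrFun (congrFun (hk p.2 q.2) p.1) q.1
  have smul : ∀ (c : ℂ) (ρ : Op (X × R)), IsTraceClass ρ → ∀ᵐ k ∂ν,
      Stretching.onLeft R (J k) (c • ρ) = c • Stretching.onLeft R (J k) ρ := by
    intro c ρ hρ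
    filter_upwards [ae_all_iff.2 fun r => ae_all_iff.2 fun r' =>
      hJ.map_smul c _ (blk hρ r r')] with k hk
    ext p q
    exact congrFun (congrFun (hk p.2 q.2) p.1) q.1
  refine ⟨fun ρ hρ => hJ.aemeasurable_onLeft hρ, add, smul, fun ρ hρ => ?_, fun m ρ hρ => ?_,
    fun ρ hρ => hJ.lintegral_posTrace_onLeft hρ⟩
  · refine hρ.induction (P := fun ρ => ∀ᵐ k ∂ν, IsTraceClass (Stretching.onLeft R (J k) ρ))
      (fun ρ h => ?_) (fun ρ τ h h' i i' => ?_) fun c ρ h i => ?_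
    · exact (hJ.isDensityFamily_onLeft h).pos.mono fun k hk => hk.isTraceClass
    · filter_upwards [i, i', add ρ τ h h'] with k h1 h2 h3
      rw [h3]; exact h1.add h2
    · filter_upwards [i, smul c ρ h] with k h1 h2
      rw [h2]; exact h1.smul c
  · filter_upwards [hJ.posSemidef_onLeft (R := R × Fin m)
      (ρ := ρ.submatrix (fun p => (p.2.2, (p.1, p.2.1))) fun p => (p.2.2, (p.1, p.2.1)))
      (hρ.submatrix fun p q => by simp +contextual [Prod.ext_iff])] with k hk
    exact hk.submatrix fun p : Fin m × (Y × R) => (p.2.1, (p.2.2, p.1))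

theorem IsInstrument.onRight (hJ : IsInstrument ν J) (R : Type) [Countable R] [Countable Y] :
    IsInstrument ν fun k => onRight R (J k) :=
  (hJ.onLeft R).reindex (Equiv.prodComm X R) (Equiv.prodComm R Y)

/-- A measurement with one certain outcome; it makes a local channel a one-round LOCC. -/
theorem IsChannel.isInstrument {Φ : Op X → Op Y} (h : IsChannel Φ) :
    IsInstrument (Measure.dirac ()) fun _ : Unit => Φ where
  aemeasurable _ _ _ _ := aemeasurable_const
  map_add ρ τ hρ hτ := .of_forall fun _ => h.map_add ρ τ hρ hτ
  map_smul c ρ hρ := .of_forall fun _ => h.map_smul c ρ hρ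
  traceClass ρ hρ := .of_forall fun _ => h.traceClass ρ hρ
  completelyPositive m ρ hρ := .of_forall fun _ => h.completelyPositive m ρ hρ
  total ρ hρ := by
    rw [lintegral_const]
    simpa [posTrace] using h.posTrace_eq hρ

end Instruments

/-! ### Averages over measurement outcomes. -/

section Averages

variable {K : Type} [MeasurableSpace K] {ν : Measure K} {X Y W : Type} [Countable X]

/-- Both the channel and its argument depend on `k`. On a finite truncation the value is a finite
sum of products of measurable functions, and the limit over truncations is countably generated
because `X` is countable. -/
theorem aemeasurable_channel_apply {Θ : K → Op X → Op Y} (hΘ : ∀ k, IsChannel (Θ k))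
    (hm : ∀ ω, IsTraceClass ω → ∀ x y, AEMeasurable (fun k => Θ k ω x y) ν)
    {ω : K → Op X} (hω : ∀ x y, AEMeasurable (fun k => ω k x y) ν)
    (htc : ∀ᵐ k ∂ν, IsTraceClass (ω k)) (x y : Y) :
    AEMeasurable (fun k => Θ k (ω k) x y) ν := by
  classical
  refine aemeasurable_of_tendsto_metrizable_ae (atTop : Filter (Finset X))
    (f := fun (F : Finset X) k => Θ k (trunc F (ω k)) x y) (fun F => ?_) ?_
  · simp only [(hΘ _).apply_trunc]
    exact Finset.aemeasurable_fun_sum _ fun a _ => Finset.aemeasurable_fun_sum _ fun b _ =>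
      (hω a b).mul (hm _ (isTraceClass_single a b) x y)
  · filter_upwards [htc] with k hk
    exact (hΘ k).tendsto_apply_trunc hk x y

theorem IsDensityFamily.map {Θ : K → Op X → Op Y} (hΘ : ∀ k, IsChannel (Θ k))
    (hm : ∀ ω, IsTraceClass ω → ∀ x y, AEMeasurable (fun k => Θ k ω x y) ν)
    {ω : K → Op X} (hω : IsDensityFamily ν ω) : IsDensityFamily ν fun k => Θ k (ω k) where
  aemeasurable := aemeasurable_channel_apply hΘ hm hω.aemeasurable
    (hω.pos.mono fun _ h => h.isTraceClass)
  pos := hω.pos.mono fun k h => (hΘ k).isPositiveTC h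
  lintegral_ne_top := by
    rw [lintegral_congr_ae (g := fun k => posTrace (ω k))
      (hω.pos.mono fun k h => (hΘ k).posTrace_eq h)]
    exact hω.lintegral_ne_top

theorem IsDensityFamily.integrable_toReal {ω : K → Op X} (hω : IsDensityFamily ν ω) :
    Integrable (fun k => (posTrace (ω k)).toReal) ν :=
  integrable_toReal_of_lintegral_ne_top (aemeasurable_posTrace hω.aemeasurable) hω.lintegral_ne_top

theorem norm_apply_le_posTrace {X : Type} {M : Op X} (hM : IsPositiveTC M) (x y : X) :
    ‖M x y‖ ≤ (posTrace M).toReal := by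
  rw [← toReal_enorm]
  exact ENNReal.toReal_mono hM.posTrace_ne_top (enorm_apply_le_posTrace hM.1 x y)

theorem IsDensityFamily.integrable {ω : K → Op X} (hω : IsDensityFamily ν ω) (x y : X) :
    Integrable (fun k => ω k x y) ν :=
  hω.integrable_toReal.mono' (hω.aemeasurable x y).aestronglyMeasurable
    (hω.pos.mono fun _ h => norm_apply_le_posTrace h x y)

/-- Channels commute with averages. -/
theorem IsChannel.apply_integral {Φ : Op X → Op Y} (h : IsChannel Φ) {ω : K → Op X}
    (hω : IsDensityFamily ν ω) {σ : Op X} (hσ : IsTraceClass σ)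
    (e : ∀ x y, σ x y = ∫ k, ω k x y ∂ν) (x y : Y) : Φ σ x y = ∫ k, Φ (ω k) x y ∂ν := by
  classical
  refine tendsto_nhds_unique (h.tendsto_apply_trunc hσ x y) ?_
  have h1 : ∀ F : Finset X, Φ (trunc F σ) x y = ∫ k, Φ (trunc F (ω k)) x y ∂ν := by
    intro F
    simp only [h.apply_trunc]
    rw [integral_finsetSum _ fun a _ => integrable_finsetSum _ fun b _ =>
      (hω.integrable a b).mul_const _]
    refine Finset.sum_congr rfl fun a _ => ?_
    rw [integral_finsetSum _ fun b _ => (hω.integrable a b).mul_const _]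
    refine Finset.sum_congr rfl fun b _ => ?_
    rw [integral_mul_const, e]
  simp only [h1]
  -- Entries of a positive operator are bounded by its trace, which the channel preserves and
  -- truncation does not increase.
  refine tendsto_integral_filter_of_dominated_convergence (fun k => (posTrace (ω k)).toReal)
    (Eventually.of_forall fun F => ?_) (Eventually.of_forall fun F => ?_) hω.integrable_toReal ?_
  · simp only [h.apply_trunc]
    exact (Finset.aemeasurable_fun_sum _ fun a _ => Finset.aemeasurable_fun_sum _ fun b _ =>
      (hω.aemeasurable a b).mul_const _).aestronglyMeasurable
  · filter_upwards [hω.pos] with k hk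
    refine (norm_apply_le_posTrace (h.isPositiveTC (hk.trunc F)) x y).trans ?_
    rw [h.posTrace_eq (hk.trunc F)]
    exact ENNReal.toReal_mono hk.posTrace_ne_top (posTrace_trunc_le _ _)
  · filter_upwards [hω.pos] with k hk
    exact h.tendsto_apply_trunc hk.isTraceClass x y

/-- An average formula for a channel extends from states to trace-class operators. -/
theorem eq_integral_of_isState [Countable Y] {L : K → Op W → Op X} (hL : IsInstrument ν L)
    {Θ : K → Op X → Op Y} (hΘ : ∀ k, IsChannel (Θ k))
    (hm : ∀ ω, IsTraceClass ω → ∀ x y, AEMeasurable (fun k => Θ k ω x y) ν)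
    {Λ : Op W → Op Y} (hΛ : IsChannel Λ)
    (h : ∀ ρ, IsState ρ → ∀ x y, Λ ρ x y = ∫ k, Θ k (L k ρ) x y ∂ν) {ρ : Op W}
    (hρ : IsTraceClass ρ) (x y : Y) : Λ ρ x y = ∫ k, Θ k (L k ρ) x y ∂ν := by
  have smul : ∀ (c : ℂ) (ρ : Op W), IsTraceClass ρ → Λ ρ x y = ∫ k, Θ k (L k ρ) x y ∂ν →
      Λ (c • ρ) x y = ∫ k, Θ k (L k (c • ρ)) x y ∂ν := by
    intro c ρ hρ e
    rw [hΛ.map_smul c ρ hρ, Matrix.smul_apply, e, smul_eq_mul, ← integral_const_mul]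
    refine integral_congr_ae ?_
    filter_upwards [hL.map_smul c ρ hρ, hL.traceClass ρ hρ] with k hk hk'
    rw [hk, (hΘ k).map_smul c _ hk', Matrix.smul_apply, smul_eq_mul]
  -- Integrability is carried through the induction, since additivity of the integral requires it.
  suffices H : Integrable (fun k => Θ k (L k ρ) x y) ν ∧ Λ ρ x y = ∫ k, Θ k (L k ρ) x y ∂ν from H.2
  refine hρ.induction (P := fun ρ => Integrable (fun k => Θ k (L k ρ) x y) ν ∧
    Λ ρ x y = ∫ k, Θ k (L k ρ) x y ∂ν) (fun ρ hρ => ?_) (fun ρ τ hρ hτ i i' => ?_)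
    fun c ρ hρ i => ⟨?_, smul c ρ hρ i.2⟩
  · refine ⟨((hL.isDensityFamily hρ).map hΘ hm).integrable x y, ?_⟩
    obtain h0 | ⟨τ, hτ, e⟩ := hρ.eq_smul_isState
    · rw [h0]
      simpa using smul 0 0 isTraceClass_zero (by
        have : ∀ᵐ k ∂ν, Θ k (L k 0) x y = 0 := by
          filter_upwards [hL.map_smul 0 0 isTraceClass_zero] with k hk
          rw [zero_smul, zero_smul] at hk
          rw [hk, (hΘ k).map_zero, Matrix.zero_apply]
        rw [integral_congr_ae this, hΛ.map_zero]
        simp)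
    · rw [e]
      exact smul _ τ hτ.isTraceClass (h τ hτ x y)
  · have ha : (fun k => Θ k (L k (ρ + τ)) x y) =ᵐ[ν]
        fun k => Θ k (L k ρ) x y + Θ k (L k τ) x y := by
      filter_upwards [hL.map_add ρ τ hρ hτ, hL.traceClass ρ hρ, hL.traceClass τ hτ]
        with k hk h1 h2
      rw [hk, (hΘ k).map_add _ _ h1 h2, Matrix.add_apply]
    refine ⟨(i.1.add i'.1).congr ha.symm, ?_⟩
    rw [hΛ.map_add ρ τ hρ hτ, integral_congr_ae ha, integral_add i.1 i'.1, Matrix.add_apply,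
      i.2, i'.2]
  · refine (i.1.const_mul c).congr ?_
    filter_upwards [hL.map_smul c ρ hρ, hL.traceClass ρ hρ] with k hk hk'
    rw [hk, (hΘ k).map_smul c _ hk', Matrix.smul_apply, smul_eq_mul]

end Averages

/-! ### Composition of LOCCs and LOCCs with memory. -/

section LOCC

variable {A B A' B' A'' B'' C D : Type} {r s : ℕ}

theorem LOCCRounds.isChannel {Λ : Op (A × B) → Op (A' × B')} (h : LOCCRounds A B A' B' r Λ) :
    IsChannel Λ := by
  cases h <;> assumption

theorem LOCCRounds.congr {Λ Λ' : Op (A × B) → Op (A' × B')} (h : LOCCRounds A B A' B' r Λ)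
    (hΛ' : IsChannel Λ') (e : ∀ ρ, IsState ρ → Λ' ρ = Λ ρ) : LOCCRounds A B A' B' r Λ' := by
  cases h with
  | done _ hΛ h => exact .done _ hΛ' fun ρ hρ => (e ρ hρ).trans (h ρ hρ)
  | alice ν J hJ Θ hΘ hm _ hΛ h =>
    exact .alice ν J hJ Θ hΘ hm _ hΛ' fun ρ hρ x y => by rw [e ρ hρ]; exact h ρ hρ x y
  | bob ν J hJ Θ hΘ hm _ hΛ h =>
    exact .bob ν J hJ Θ hΘ hm _ hΛ' fun ρ hρ x y => by rw [e ρ hρ]; exact h ρ hρ x y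

/-- The rounds of `Ψ` are appended in every branch of `Λ`; the average is the right one because `Ψ`
commutes with integrals over outcomes. -/
theorem LOCCRounds.comp {Λ : Op (A × B) → Op (A' × B')} (h : LOCCRounds A B A' B' r Λ)
    [hA : Countable A] [hB : Countable B] [hA' : Countable A'] [hB' : Countable B']
    {Ψ : Op (A' × B') → Op (A'' × B'')} (hΨ : LOCCRounds A' B' A'' B'' s Ψ) :
    LOCCRounds A B A'' B'' (s + r) fun ρ => Ψ (Λ ρ) := by
  -- A round changes the local systems, so their countability instances must be general in the
  -- induction.
  revert hA hB hA' hB' Ψ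
  induction h with
  | done Λ hΛ h =>
    intro _ _ _ _ Ψ hΨ
    have cΨ := hΨ.isChannel
    exact hΨ.congr (cΨ.comp hΛ) fun ρ hρ => by rw [h ρ hρ]
  | @alice A B A₁ _ _ _ r K _ ν _ J hJ Θ hΘ hm Λ hΛ h ih =>
    intro _ _ _ _ Ψ hΨ
    have cΨ := hΨ.isChannel
    refine .alice ν J hJ (fun k ρ => Ψ (Θ k ρ)) (fun k => ih k hΨ) (fun ω hω x y => ?_) _
      (cΨ.comp hΛ) fun ρ hρ x y => ?_
    · exact aemeasurable_channel_apply (fun _ => cΨ) (fun _ _ _ _ => aemeasurable_const)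
        (hm ω hω) (.of_forall fun k => (hΘ k).isChannel.traceClass ω hω) x y
    · exact cΨ.apply_integral (((hJ.onLeft B).isDensityFamily hρ.isPositiveTC).map
        (fun k => (hΘ k).isChannel) hm) (hΛ.traceClass ρ hρ.isTraceClass) (h ρ hρ) x y
  | @bob A B B₁ _ _ _ r K _ ν _ J hJ Θ hΘ hm Λ hΛ h ih =>
    intro _ _ _ _ Ψ hΨ
    have cΨ := hΨ.isChannel
    refine .bob ν J hJ (fun k ρ => Ψ (Θ k ρ)) (fun k => ih k hΨ) (fun ω hω x y => ?_) _
      (cΨ.comp hΛ) fun ρ hρ x y => ?_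
    · exact aemeasurable_channel_apply (fun _ => cΨ) (fun _ _ _ _ => aemeasurable_const)
        (hm ω hω) (.of_forall fun k => (hΘ k).isChannel.traceClass ω hω) x y
    · exact cΨ.apply_integral (((hJ.onRight A).isDensityFamily hρ.isPositiveTC).map
        (fun k => (hΘ k).isChannel) hm) (hΛ.traceClass ρ hρ.isTraceClass) (h ρ hρ) x y

/-- `Λ ⊗ I`, where the two parties keep additional systems `C` and `D`. -/
def withMemory (C D : Type) (Λ : Op (A × B) → Op (A' × B')) (ρ : Op ((A × C) × (B × D))) :
    Op ((A' × C) × (B' × D)) := fun p q =>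
  Λ (fun x y => ρ ((x.1, p.1.2), (x.2, p.2.2)) ((y.1, q.1.2), (y.2, q.2.2)))
    (p.1.1, p.2.1) (q.1.1, q.2.1)

theorem IsTraceClass.memoryBlock {ρ : Op ((A × C) × (B × D))} (hρ : IsTraceClass ρ)
    (c c' : C) (d d' : D) :
    IsTraceClass (fun x y => ρ ((x.1, c), (x.2, d)) ((y.1, c'), (y.2, d')) : Op (A × B)) := by
  have : ∀ (c : C) (d : D), Function.Injective fun x : A × B => ((x.1, c), (x.2, d)) :=
    fun c d x y h => by simpa [Prod.ext_iff] using h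
  exact hρ.block (this c d) (this c' d')

theorem IsChannel.withMemory {Λ : Op (A × B) → Op (A' × B')} (h : IsChannel Λ) (C D : Type) :
    IsChannel (withMemory C D Λ) :=
  (isChannel_reindex (Equiv.prodProdProdComm A' C B' D)).comp
    ((h.onLeft (C × D)).comp (isChannel_reindex (Equiv.prodProdProdComm A B C D)))

/-- Each instrument is tensored with the identity on the memory of its party. The averaging formula
is then needed on memory blocks, which are trace class but not states, hence the use of
`eq_integral_of_isState`. -/
theorem LOCCRounds.withMemory {Λ : Op (A × B) → Op (A' × B')} (h : LOCCRounds A B A' B' r Λ)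
    [hA : Countable A] [hB : Countable B] [hA' : Countable A'] [hB' : Countable B']
    [Countable C] [Countable D] :
    LOCCRounds (A × C) (B × D) (A' × C) (B' × D) r (withMemory C D Λ) := by
  revert hA hB hA' hB'
  induction h with
  | done Λ hΛ h =>
    intro _ _ _ _
    refine (LOCCRounds.done _ isChannel_id fun _ _ => rfl).congr (hΛ.withMemory C D)
      fun ρ hρ => ?_
    ext p q
    exact congrFun (congrFun (hΛ.eq_of_isState isChannel_id h
      (hρ.isTraceClass.memoryBlock p.1.2 q.1.2 p.2.2 q.2.2)) _) _
  | @alice A B A₁ _ _ _ r K _ ν _ J hJ Θ hΘ hm Λ hΛ h ih =>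
    intro _ _ _ _
    refine .alice ν _ (hJ.onLeft C) (fun k => Stretching.withMemory C D (Θ k)) (fun k => ih k)
      (fun ω hω x y => hm _ (hω.memoryBlock _ _ _ _) _ _) _ (hΛ.withMemory C D)
      fun ρ hρ x y => ?_
    exact eq_integral_of_isState (hJ.onLeft B) (fun k => (hΘ k).isChannel) hm hΛ h
      (hρ.isTraceClass.memoryBlock _ _ _ _) _ _
  | @bob A B B₁ _ _ _ r K _ ν _ J hJ Θ hΘ hm Λ hΛ h ih =>
    intro _ _ _ _
    refine .bob ν _ (hJ.onLeft D) (fun k => Stretching.withMemory C D (Θ k)) (fun k => ih k)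
      (fun ω hω x y => hm _ (hω.memoryBlock _ _ _ _) _ _) _ (hΛ.withMemory C D)
      fun ρ hρ x y => ?_
    exact eq_integral_of_isState (hJ.onRight A) (fun k => (hΘ k).isChannel) hm hΛ h
      (hρ.isTraceClass.memoryBlock _ _ _ _) _ _

theorem IsLOCC.comp [Countable A] [Countable B] [Countable A'] [Countable B']
    {Ψ : Op (A' × B') → Op (A'' × B'')} (hΨ : IsLOCC Ψ) {Λ : Op (A × B) → Op (A' × B')}
    (hΛ : IsLOCC Λ) : IsLOCC fun ρ => Ψ (Λ ρ) := by
  obtain ⟨r, hr⟩ := hΛ.2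
  obtain ⟨s, hs⟩ := hΨ.2
  exact ⟨hΨ.1.comp hΛ.1, s + r, hr.comp hs⟩

theorem IsLOCC.withMemory [Countable A] [Countable B] [Countable A'] [Countable B'] [Countable C]
    [Countable D] {Λ : Op (A × B) → Op (A' × B')} (hΛ : IsLOCC Λ) :
    IsLOCC (withMemory C D Λ) := by
  obtain ⟨r, hr⟩ := hΛ.2
  exact ⟨hΛ.1.withMemory C D, r, hr.withMemory⟩

theorem IsChannel.isLOCC_onLeft [Countable A'] {Φ : Op A → Op A'} (h : IsChannel Φ) (B : Type) :
    IsLOCC (Stretching.onLeft B Φ) :=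
  ⟨h.onLeft B, 1, .alice _ _ h.isInstrument (fun _ ρ => ρ)
    (fun _ => .done _ isChannel_id fun _ _ => rfl) (fun _ _ _ _ => aemeasurable_const) _
    (h.onLeft B) fun ρ _ x y => by simp⟩

theorem IsChannel.isLOCC_onRight [Countable B'] {Φ : Op B → Op B'} (h : IsChannel Φ) (A : Type) :
    IsLOCC (Stretching.onRight A Φ) :=
  ⟨h.onRight A, 1, .bob _ _ h.isInstrument (fun _ ρ => ρ)
    (fun _ => .done _ isChannel_id fun _ _ => rfl) (fun _ _ _ _ => aemeasurable_const) _
    (h.onRight A) fun ρ _ x y => by simp⟩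

theorem isLOCC_reindex [Countable A] [Countable B] [Countable A'] [Countable B'] (e : A' ≃ A)
    (f : B' ≃ B) :
    IsLOCC fun ρ : Op (A × B) => (ρ.submatrix (Prod.map e f) (Prod.map e f) : Op (A' × B')) :=
  ((isChannel_reindex f).isLOCC_onRight A').comp ((isChannel_reindex e).isLOCC_onLeft B)

end LOCC

/-! ### Stretching an adaptive protocol with an exact simulation. -/

section Simulation

variable {a b A B K S : QSystem}

theorem isChannel_simulate {T : Op ((a.prod A).prod B).idx → Op (QSystem.triv.prod b).idx}
    (hT : IsChannel T) {σ : Op (A.prod B).idx} (hσ : IsState σ) : IsChannel (simulate T σ) :=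
  (isChannel_reindex (Equiv.punitProd b.idx).symm).comp
    (hT.comp ((isChannel_reindex (Equiv.prodAssoc a.idx A.idx B.idx)).comp (isChannel_tensor hσ)))

/-- The regrouping of Alice's and Bob's kept systems next to the transmitted one. -/
def regroup (K S X : Type) : (K × S) × X ≃ (K × X) × S where
  toFun p := ((p.1.1, p.2), p.1.2)
  invFun p := ((p.1.1, p.2), p.1.2)
  left_inv _ := rfl
  right_inv _ := rfl

/-- The regrouping of the kept systems around the received one. -/
def distribute (K S Y : Type) : K × (Y × S) ≃ (K × S) × Y where
  toFun p := ((p.1, p.2.2), p.2.1)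
  invFun p := (p.1.1, (p.2, p.1.2))
  left_inv _ := rfl
  right_inv _ := rfl

theorem transmission_eq (E : Op a.idx → Op b.idx) (ρ : Op ((K.prod a).prod S).idx) :
    transmission K S E ρ = (onRight (K.idx × S.idx) E (ρ.submatrix (regroup K.idx S.idx a.idx)
      (regroup K.idx S.idx a.idx))).submatrix (distribute K.idx S.idx b.idx)
      (distribute K.idx S.idx b.idx) := rfl

theorem isChannel_transmission {E : Op a.idx → Op b.idx} (hE : IsChannel E) :
    IsChannel (transmission K S E) :=
  (isChannel_reindex (distribute K.idx S.idx b.idx)).comp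
    ((hE.onRight _).comp (isChannel_reindex (regroup K.idx S.idx a.idx)))

theorem isState_tensor {X Y : Type} {ρ : Op X} {τ : Op Y} (hρ : IsState ρ) (hτ : IsState τ) :
    IsState (tensor ρ τ) := (isChannel_tensor hτ).isState hρ

theorem AdaptiveProtocol.isState_output {E : Op a.idx → Op b.idx} (hE : IsChannel E) :
    ∀ {n : ℕ} {X Y : QSystem} (P : AdaptiveProtocol a b n X Y), IsState (P.output E)
  | _, _, _, .prepare _ hA _ hB _ hΛ => hΛ.1.isState (isState_tensor hA hB)
  | _, _, _, .transmit P _ hΛ =>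
    hΛ.1.isState ((isChannel_transmission hE).isState (P.isState_output hE))

/-- Splitting off the last of `n + 1` systems. -/
def snocEquiv (n : ℕ) (X : Type) : (Fin n → X) × X ≃ (Fin (n + 1) → X) :=
  (Equiv.prodComm _ _).trans (Fin.snocEquiv fun _ => X)

theorem tensorPower_succ (σ : Op (A.prod B).idx) (n : ℕ) :
    (tensorPower σ (n + 1)).submatrix (Prod.map (snocEquiv n A.idx) (snocEquiv n B.idx))
      (Prod.map (snocEquiv n A.idx) (snocEquiv n B.idx)) =
    fun p q => σ (p.1.2, p.2.2) (q.1.2, q.2.2) * tensorPower σ n (p.1.1, p.2.1) (q.1.1, q.2.1) := by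
  ext p q
  simp [tensorPower, Fin.prod_univ_castSucc, snocEquiv, mul_comm]

theorem isState_tensorPower {σ : Op (A.prod B).idx} (hσ : IsState σ) (n : ℕ) :
    IsState (tensorPower σ n) := by
  induction n with
  | zero =>
    have : IsState (fun _ _ => 1 : Op ((A.pow 0).prod (B.pow 0)).idx) := by
      have : Unique ((A.pow 0).prod (B.pow 0)).idx :=
        ⟨⟨(default, default)⟩, fun _ => Subsingleton.elim _ _⟩
      refine ⟨?_, by simp⟩
      have h1 : (1 : Op Unit).PosSemidef := Matrix.PosSemidef.one
      have := h1.submatrix fun _ : ((A.pow 0).prod (B.pow 0)).idx => ()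
      refine (congrArg Matrix.PosSemidef ?_).mpr this
      ext x y
      simp
    refine (congrArg IsState ?_).mpr this
    ext p q
    simp [tensorPower]
  | succ n ih =>
    have h1 := (isChannel_reindex (Equiv.prodProdProdComm (Fin n → A.idx) A.idx (Fin n → B.idx)
      B.idx)).isState (isState_tensor ih hσ)
    have h2 := (isChannel_reindex ((snocEquiv n A.idx).symm.prodCongr
      (snocEquiv n B.idx).symm)).isState h1
    refine (congrArg IsState ?_).mpr h2
    have e := tensorPower_succ σ n
    ext p q
    have := congrFun (congrFun e (((snocEquiv n A.idx).symm p.1), ((snocEquiv n B.idx).symm p.2)))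
      (((snocEquiv n A.idx).symm q.1), ((snocEquiv n B.idx).symm q.2))
    simp only [Matrix.submatrix_apply, Prod.map, Equiv.apply_symm_apply] at this
    exact this.trans (mul_comm _ _)

/-- The base case: `σ^{⊗0}` lives on one-dimensional systems, and each party attaches a local state
to its side. -/
theorem exists_isLOCC_prepare {ι κ : Type} [Unique ι] [Unique κ] {ρA : Op A.idx} (hA : IsState ρA)
    {ρB : Op B.idx} (hB : IsState ρB) : ∃ Λ : Op (ι × κ) → Op (A.idx × B.idx), IsLOCC Λ ∧
      Λ (fun _ _ => 1) = tensor ρA ρB := by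
  have h1 := (((isChannel_reindex (Equiv.uniqueProd A.idx ι).symm).comp
    (isChannel_tensor hA)).isLOCC_onLeft κ)
  have h2 := (((isChannel_reindex (Equiv.uniqueProd B.idx κ).symm).comp
    (isChannel_tensor hB)).isLOCC_onRight A.idx)
  have : Countable ι := inferInstance
  have : Countable κ := inferInstance
  refine ⟨_, h2.comp h1, ?_⟩
  ext p q
  simp [onLeft, onRight, tensor]

/-- Teleportation stretching of an adaptive protocol. -/
theorem AdaptiveProtocol.exists_stretching {E : Op a.idx → Op b.idx} (hE : IsChannel E)
    {σ : Op (A.prod B).idx} (hσ : IsState σ)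
    {T : Op ((a.prod A).prod B).idx → Op (QSystem.triv.prod b).idx} (hT : IsLOCC T)
    (e : ∀ ρ, IsState ρ → E ρ = simulate T σ ρ) {n : ℕ} {X Y : QSystem}
    (P : AdaptiveProtocol a b n X Y) :
    ∃ Λ : Op ((A.pow n).prod (B.pow n)).idx → Op (X.prod Y).idx,
      IsLOCC Λ ∧ P.output E = Λ (tensorPower σ n) := by
  induction P with
  | prepare ρA hA ρB hB Λ₀ hΛ₀ =>
    obtain ⟨Λ, hΛ, e⟩ := exists_isLOCC_prepare (ι := Fin 0 → A.idx) (κ := Fin 0 → B.idx) hA hB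
    refine ⟨fun ρ => Λ₀ (Λ ρ), hΛ₀.comp hΛ, ?_⟩
    have : Λ (tensorPower σ 0) = tensor ρA ρB := by
      rw [← e]
      congr 1
    exact congrArg Λ₀ this.symm
  | @transmit n K S X Y P Λ hΛ ih =>
    obtain ⟨Λn, hΛn, en⟩ := ih
    -- The new LOCC splits off the last copy of `σ`, runs the stretched `n`-use protocol with that
    -- copy as memory, moves the system to be sent next to the copy, simulates the channel with `K`
    -- and `S` as memory, and discards the trivial output of Alice. All relabellings are local.
    have h0 := isLOCC_reindex (snocEquiv n A.idx) (snocEquiv n B.idx)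
    have h1 := hΛn.withMemory (C := A.idx) (D := B.idx)
    have h2 := isLOCC_reindex ((Equiv.prodComm (a.idx × A.idx) K.idx).trans
      (Equiv.prodAssoc K.idx a.idx A.idx).symm) (Equiv.prodComm B.idx S.idx)
    have h3 := hT.withMemory (C := K.idx) (D := S.idx)
    have h4 := isLOCC_reindex (Equiv.punitProd K.idx).symm (Equiv.refl (b.idx × S.idx))
    refine ⟨_, hΛ.comp (h4.comp (h3.comp (h2.comp (h1.comp h0)))), congrArg Λ ?_⟩
    -- Each memory block is an entry of the last `σ` times `σ^{⊗n}`, so homogeneity of `Λn` is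
    -- enough.
    have key : Stretching.withMemory A.idx B.idx Λn ((tensorPower σ (n + 1)).submatrix
        (Prod.map (snocEquiv n A.idx) (snocEquiv n B.idx))
        (Prod.map (snocEquiv n A.idx) (snocEquiv n B.idx))) =
        fun p q => P.output E (p.1.1, p.2.1) (q.1.1, q.2.1) * σ (p.1.2, p.2.2) (q.1.2, q.2.2) := by
      rw [tensorPower_succ]
      ext p q
      have := hΛn.1.map_smul (σ (p.1.2, p.2.2) (q.1.2, q.2.2)) _
        (isState_tensorPower hσ n).isTraceClass
      rw [← en] at this
      exact (congrFun (congrFun this _) _).trans (mul_comm _ _)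
    rw [key]
    ext p q
    have hinj : ∀ r : K.idx × (b.idx × S.idx),
        Function.Injective fun x : a.idx => ((r.1, x), r.2.2) := fun r x y h => by
      simpa using h
    -- The simulation is given on states, but it is applied here to the off-diagonal blocks of the
    -- register state.
    exact congrFun (congrFun (hE.eq_of_isState (isChannel_simulate hT.1 hσ) e
      ((P.isState_output hE).isTraceClass.block (hinj p) (hinj q))) p.2.1) q.2.1

end Simulation

/-! ### Propagation of simulation errors through a protocol. -/

section Convergence

variable {a b : QSystem}

theorem traceNorm_sub_le_add {X : Type} (M N L : Op X) :
    traceNorm (M - L) ≤ traceNorm (M - N) + traceNorm (N - L) := by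
  rw [← sub_add_sub_cancel M N L]
  exact traceNorm_add_le _ _

/-- One use of the channel adds at most the simulation error on the current register state. -/
theorem traceNorm_transmit_sub_le {K S X Y : QSystem} {E E' : Op a.idx → Op b.idx}
    (hE : IsChannel E) (hE' : IsChannel E') {Λ : Op (K.prod (b.prod S)).idx → Op (X.prod Y).idx}
    (hΛ : IsChannel Λ) {ρ τ : Op ((K.prod a).prod S).idx} (hρ : IsState ρ) (hτ : IsState τ) :
    traceNorm (Λ (transmission K S E ρ) - Λ (transmission K S E' τ)) ≤
      traceNorm (onRight (K.prod S).idx E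
          (ρ.submatrix (regroup K.idx S.idx a.idx) (regroup K.idx S.idx a.idx)) -
        onRight (K.prod S).idx E'
          (ρ.submatrix (regroup K.idx S.idx a.idx) (regroup K.idx S.idx a.idx))) +
      traceNorm (ρ - τ) := by
  have c := isChannel_transmission (K := K) (S := S) hE
  have c' := isChannel_transmission (K := K) (S := S) hE'
  have hρ' := (isChannel_reindex (regroup K.idx S.idx a.idx)).isState hρ
  -- After removing `Λ` by contractivity, the intermediate point is the transmission of `ρ` through
  -- `E'`: one leg compares the channels on `ρ`, the other is contracted by `E'`.
  refine (hΛ.traceNorm_sub_le (c.isState hρ).isPositiveTC (c'.isState hτ).isPositiveTC).trans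
    ((traceNorm_sub_le_add _ (transmission K S E' ρ) _).trans (add_le_add ?_
      (c'.traceNorm_sub_le hρ.isPositiveTC hτ.isPositiveTC)))
  rw [transmission_eq, transmission_eq]
  exact (isChannel_reindex (distribute K.idx S.idx b.idx)).traceNorm_sub_le
    ((hE.onRight _).isState hρ').isPositiveTC ((hE'.onRight _).isState hρ').isPositiveTC

/-- Every error is evaluated on the register states of the ideal protocol. These are fixed along
`l`, so pointwise convergence suffices. -/
theorem AdaptiveProtocol.tendsto_traceNorm_output_sub {I : Type} {l : Filter I}
    {E : Op a.idx → Op b.idx} {E' : I → Op a.idx → Op b.idx} (hE : IsChannel E)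
    (hE' : ∀ i, IsChannel (E' i))
    (h : ∀ (R : QSystem) (ρ : Op (R.prod a).idx), IsState ρ →
      Tendsto (fun i => traceNorm (onRight R.idx E ρ - onRight R.idx (E' i) ρ)) l (𝓝 0))
    {n : ℕ} {X Y : QSystem} (P : AdaptiveProtocol a b n X Y) :
    Tendsto (fun i => traceNorm (P.output E - P.output (E' i))) l (𝓝 0) := by
  induction P with
  | prepare ρA hA ρB hB Λ₀ hΛ₀ => simpa [output] using tendsto_const_nhds
  | @transmit n K S X Y P Λ hΛ ih =>
    have h1 := h (K.prod S) _ ((isChannel_reindex (regroup K.idx S.idx a.idx)).isState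
      (P.isState_output hE))
    have h2 := h1.add ih
    rw [add_zero] at h2
    exact tendsto_of_tendsto_of_tendsto_of_le_of_le tendsto_const_nhds h2 (fun _ => bot_le)
      fun i => traceNorm_transmit_sub_le hE (hE' i) hΛ.1 (P.isState_output hE)
        (P.isState_output (hE' i))

theorem AdaptiveProtocol.traceNorm_output_sub_le {E E' : Op a.idx → Op b.idx} (hE : IsChannel E)
    (hE' : IsChannel E') {n : ℕ} {X Y : QSystem} (P : AdaptiveProtocol a b n X Y)
    (hP : P.HasBosonicRegisters) (N : ℕ → ℝ≥0) (hN : P.EnergyBounded E N) :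
    traceNorm (P.output E - P.output E') ≤ ∑ k ∈ Finset.range n, boundedDiamond E E' (N k) := by
  induction P with
  | prepare ρA hA ρB hB Λ₀ hΛ₀ => simp [output]
  | @transmit n K S X Y P Λ hΛ ih =>
    rw [Finset.sum_range_succ]
    refine le_of_le_of_eq ?_ (add_comm _ _)
    refine (traceNorm_transmit_sub_le hE hE' hΛ.1 (P.isState_output hE)
      (P.isState_output hE')).trans (add_le_add ?_ (ih hP.2.2 hN.2))
    refine le_iSup_of_le (K.prod S) (le_iSup_of_le (hP.1.prod hP.2.1) (le_iSup_of_le _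
      (le_iSup_of_le ((isChannel_reindex (regroup K.idx S.idx a.idx)).isState
        (P.isState_output hE)) (le_iSup_of_le ?_ le_rfl))))
    -- Regrouping the registers preserves the total photon number.
    refine le_trans (le_of_eq ?_) hN.1
    refine Eq.trans (tsum_congr fun p => ?_) ((regroup K.idx S.idx a.idx).tsum_eq fun p =>
      ENNReal.ofReal (P.output E p p).re * (((K.prod a).prod S).number p : ℝ≥0∞))
    simp [QSystem.prod, regroup, add_right_comm]

end Convergence

/-! ### From pointwise convergence to energy-bounded diamond norms. -/

section BoundedDiamond

variable {a b : QSystem} {I : Type} {l : Filter I} {E : Op a.idx → Op b.idx}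
  {E' : I → Op a.idx → Op b.idx}

/-- Attaching the state proportional to `τ` is a channel, hence contractive. -/
theorem traceNorm_tensor_sub_le {R X : Type} {τ : Op R} (hτ : IsPositiveTC τ) {ρ ρ' : Op X}
    (hρ : IsPositiveTC ρ) (hρ' : IsPositiveTC ρ') :
    traceNorm (tensor τ (ρ - ρ')) ≤ posTrace τ * traceNorm (ρ - ρ') := by
  obtain rfl | ⟨s, hs, e⟩ := hτ.eq_smul_isState
  · have : tensor (0 : Op R) (ρ - ρ') = 0 := by ext p q; simp [tensor]
    simp [this]
  · have h1 := ((isChannel_reindex (Equiv.prodComm R X)).comp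
      (isChannel_tensor (X := X) hs)).traceNorm_sub_le hρ hρ'
    have h2 : tensor τ (ρ - ρ') = ((posTrace τ).toReal : ℂ) •
        ((tensor ρ s).submatrix (Equiv.prodComm R X) (Equiv.prodComm R X) -
          (tensor ρ' s).submatrix (Equiv.prodComm R X) (Equiv.prodComm R X)) := by
      conv_lhs => rw [e]
      ext p q
      simp [tensor]
      ring
    rw [h2]
    refine (traceNorm_smul_le _ _).trans ?_
    gcongr
    rw [← ofReal_norm, Complex.norm_real, Real.norm_of_nonneg ENNReal.toReal_nonneg,
      ENNReal.ofReal_toReal hτ.posTrace_ne_top]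

theorem tensor_add {R X : Type} (τ : Op R) (M N : Op X) :
    tensor τ (M + N) = tensor τ M + tensor τ N := by
  ext p q; simp [tensor, mul_add]

theorem tensor_smul {R X : Type} (τ : Op R) (c : ℂ) (M : Op X) :
    tensor τ (c • M) = c • tensor τ M := by
  ext p q; simp [tensor, mul_left_comm]

theorem tendsto_traceNorm_sub (hE : IsChannel E) (hE' : ∀ i, IsChannel (E' i))
    (h : ∀ (R : QSystem) (ρ : Op (R.prod a).idx), IsState ρ →
      Tendsto (fun i => traceNorm (onRight R.idx E ρ - onRight R.idx (E' i) ρ)) l (𝓝 0))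
    {s : Op a.idx} (hs : IsState s) :
    Tendsto (fun i => traceNorm (E s - E' i s)) l (𝓝 0) := by
  have hs' : IsState (s.submatrix Prod.snd Prod.snd : Op (Unit × a.idx)) :=
    (isChannel_reindex (Equiv.punitProd a.idx)).isState hs
  refine tendsto_of_tendsto_of_tendsto_of_le_of_le tendsto_const_nhds
    (h QSystem.triv _ hs') (fun _ => bot_le) fun i => ?_
  have e : ∀ E : Op a.idx → Op b.idx, E s =
      (onRight Unit E (s.submatrix Prod.snd Prod.snd)).submatrix (Equiv.punitProd b.idx).symm
        (Equiv.punitProd b.idx).symm := fun E => rfl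
  have := (isChannel_reindex (Equiv.punitProd b.idx).symm).traceNorm_sub_le
    ((hE.onRight Unit).isState hs').isPositiveTC (((hE' i).onRight Unit).isState hs').isPositiveTC
  rwa [← e, ← e] at this

/-- Pointwise convergence of channels is uniform over ancillas in a product state. -/
theorem exists_tendsto_traceNorm_tensor_le (hE : IsChannel E) (hE' : ∀ i, IsChannel (E' i))
    (h : ∀ (R : QSystem) (ρ : Op (R.prod a).idx), IsState ρ →
      Tendsto (fun i => traceNorm (onRight R.idx E ρ - onRight R.idx (E' i) ρ)) l (𝓝 0))
    {ω : Op a.idx} (hω : IsTraceClass ω) :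
    ∃ δ : I → ℝ≥0∞, Tendsto δ l (𝓝 0) ∧ ∀ (R : Type) (τ : Op R), IsPositiveTC τ →
      ∀ i, traceNorm (tensor τ (E ω - E' i ω)) ≤ posTrace τ * δ i := by
  have smul : ∀ (c : ℂ) (ω : Op a.idx), IsTraceClass ω →
      (∃ δ : I → ℝ≥0∞, Tendsto δ l (𝓝 0) ∧ ∀ (R : Type) (τ : Op R), IsPositiveTC τ →
        ∀ i, traceNorm (tensor τ (E ω - E' i ω)) ≤ posTrace τ * δ i) →
      ∃ δ : I → ℝ≥0∞, Tendsto δ l (𝓝 0) ∧ ∀ (R : Type) (τ : Op R), IsPositiveTC τ →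
        ∀ i, traceNorm (tensor τ (E (c • ω) - E' i (c • ω))) ≤ posTrace τ * δ i := by
    rintro c ω hω ⟨δ, hδ, H⟩
    refine ⟨fun i => ‖c‖ₑ * δ i, by
      simpa using ENNReal.Tendsto.const_mul hδ (Or.inr (enorm_ne_top (x := c))),
      fun R τ hτ i => ?_⟩
    rw [hE.map_smul c ω hω, (hE' i).map_smul c ω hω, ← smul_sub, tensor_smul, mul_left_comm]
    exact (traceNorm_smul_le _ _).trans (by gcongr; exact H R τ hτ i)
  refine hω.induction (P := fun ω => ∃ δ : I → ℝ≥0∞, Tendsto δ l (𝓝 0) ∧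
    ∀ (R : Type) (τ : Op R), IsPositiveTC τ →
      ∀ i, traceNorm (tensor τ (E ω - E' i ω)) ≤ posTrace τ * δ i) (fun ω hω => ?_) ?_ smul
  · obtain rfl | ⟨s, hs, e⟩ := hω.eq_smul_isState
    · refine ⟨fun _ => 0, tendsto_const_nhds, fun R τ hτ i => ?_⟩
      have : tensor τ (0 : Op b.idx) = 0 := by ext p q; simp [tensor]
      simp [hE.map_zero, (hE' i).map_zero, this]
    · rw [e]
      exact smul _ s hs.isTraceClass ⟨fun i => traceNorm (E s - E' i s),
        tendsto_traceNorm_sub hE hE' h hs, fun R τ hτ i =>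
        traceNorm_tensor_sub_le hτ (hE.isPositiveTC hs.isPositiveTC)
          ((hE' i).isPositiveTC hs.isPositiveTC)⟩
  · rintro ω ω' hω hω' ⟨δ, hδ, H⟩ ⟨δ', hδ', H'⟩
    refine ⟨fun i => δ i + δ' i, by simpa using hδ.add hδ', fun R τ hτ i => ?_⟩
    rw [hE.map_add ω ω' hω hω', (hE' i).map_add ω ω' hω hω', add_sub_add_comm, tensor_add, mul_add]
    exact (traceNorm_add_le _ _).trans (add_le_add (H R τ hτ i) (H' R τ hτ i))

theorem onRight_trunc_apply [DecidableEq a.idx] (hE : IsChannel E) {R : Type} (F : Finset a.idx)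
    (ρ : Op (R × a.idx)) (p q : R × b.idx) :
    onRight R E (trunc {r | r.2 ∈ F} ρ) p q =
      ∑ x ∈ F, ∑ y ∈ F, ρ (p.1, x) (q.1, y) * E (Matrix.single x y 1) p.2 q.2 :=
  hE.apply_trunc F (fun x x' => ρ (p.1, x) (q.1, x')) p.2 q.2

/-- Pointwise convergence of channels is uniform over the states of an ancilla and finitely many
basis vectors of the input. -/
theorem exists_tendsto_traceNorm_trunc_le (hE : IsChannel E) (hE' : ∀ i, IsChannel (E' i))
    (h : ∀ (R : QSystem) (ρ : Op (R.prod a).idx), IsState ρ →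
      Tendsto (fun i => traceNorm (onRight R.idx E ρ - onRight R.idx (E' i) ρ)) l (𝓝 0))
    (F : Finset a.idx) :
    ∃ δ : I → ℝ≥0∞, Tendsto δ l (𝓝 0) ∧ ∀ (R : Type) (ρ : Op (R × a.idx)), IsState ρ →
      ∀ i, traceNorm (onRight R E (trunc {r | r.2 ∈ F} ρ) -
        onRight R (E' i) (trunc {r | r.2 ∈ F} ρ)) ≤ δ i := by
  classical
  choose δ hδ H using fun x y : a.idx =>
    exists_tendsto_traceNorm_tensor_le hE hE' h (isTraceClass_single x y)
  -- Each ancilla block of a state polarizes into four positive parts of trace at most `2 * (1 + 1)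
  -- = 4`; their coefficients have modulus at most `1`.
  refine ⟨fun i => ∑ x ∈ F, ∑ y ∈ F, ∑ _j : Fin 4, 4 * δ x y i, ?_, fun R ρ hρ i => ?_⟩
  · have : ∀ x y, Tendsto (fun i => 4 * δ x y i) l (𝓝 0) := fun x y => by
      simpa using ENNReal.Tendsto.const_mul (hδ x y) (Or.inr (by simp : (4 : ℝ≥0∞) ≠ ⊤))
    simpa using tendsto_finsetSum F fun x _ => tendsto_finsetSum F fun y _ =>
      tendsto_finsetSum (Finset.univ : Finset (Fin 4)) fun _ _ => this x y
  -- Expansion in matrix units of the input. The ancilla enters only through the left tensor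
  -- factors, the channels only through the right ones.
  have e : onRight R E (trunc {r | r.2 ∈ F} ρ) - onRight R (E' i) (trunc {r | r.2 ∈ F} ρ) =
      ∑ x ∈ F, ∑ y ∈ F, tensor (fun r r' => ρ (r, x) (r', y))
        (E (Matrix.single x y 1) - E' i (Matrix.single x y 1)) := by
    ext p q
    rw [Matrix.sub_apply, onRight_trunc_apply hE, onRight_trunc_apply (hE' i),
      ← Finset.sum_sub_distrib, Matrix.sum_apply]
    refine Finset.sum_congr rfl fun x _ => ?_
    rw [← Finset.sum_sub_distrib, Matrix.sum_apply]
    refine Finset.sum_congr rfl fun y _ => ?_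
    simp [tensor, mul_sub]
  rw [e]
  refine (traceNorm_sum_le _ _).trans (Finset.sum_le_sum fun x _ => (traceNorm_sum_le _ _).trans
    (Finset.sum_le_sum fun y _ => ?_))
  have hblk : ∀ x : a.idx, posTrace (ρ.submatrix (fun r : R => (r, x)) fun r => (r, x)) ≤ 1 :=
    fun x => (posTrace_submatrix_le ρ (Prod.mk_left_injective x)).trans_eq (isState_iff.1 hρ).2
  obtain ⟨τ, hτ, hle, eτ⟩ := exists_polarization hρ.1
    (ne_top_of_le_ne_top ENNReal.one_ne_top (hblk x))
    (ne_top_of_le_ne_top ENNReal.one_ne_top (hblk y))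
  have e2 : tensor (fun r r' => ρ (r, x) (r', y))
      (E (Matrix.single x y 1) - E' i (Matrix.single x y 1)) =
      ∑ j : Fin 4, (Complex.I ^ (j : ℕ) / 4) •
        tensor (τ j) (E (Matrix.single x y 1) - E' i (Matrix.single x y 1)) := by
    ext p q
    have := congrFun (congrFun eτ p.1) q.1
    simp only [Matrix.sum_apply, Matrix.smul_apply, smul_eq_mul, tensor] at this ⊢
    rw [this, Finset.sum_mul]
    exact Finset.sum_congr rfl fun j _ => by ring
  rw [e2]
  refine (traceNorm_sum_le _ _).trans (Finset.sum_le_sum fun j _ => ?_)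
  refine (traceNorm_smul_le _ _).trans ?_
  have hI : ‖Complex.I ^ (j : ℕ) / 4‖ₑ ≤ 1 := by
    rw [← ofReal_norm, ENNReal.ofReal_le_one]
    simp
    norm_num
  refine (mul_le_of_le_one_left bot_le hI).trans ((H x y R (τ j) (hτ j) i).trans ?_)
  gcongr
  refine (hle j).trans ?_
  calc 2 * _ ≤ 2 * ((1 : ℝ≥0∞) + 1) := by gcongr <;> apply hblk
    _ = 4 := by norm_num

/-- Markov's inequality: outside `F` the input alone already carries at least `m + 1` photons. -/
theorem posTrace_trunc_compl_le_of_meanNumber {R : QSystem} (ρ : Op (R.prod a).idx) {N : ℝ≥0∞}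
    (hN : (R.prod a).meanNumber ρ ≤ N) {F : Finset a.idx} {m : ℕ}
    (hF : ∀ x, a.number x ≤ m → x ∈ F) :
    posTrace (trunc {r : R.idx × a.idx | r.2 ∈ F}ᶜ ρ) ≤ N / (m + 1) := by
  rw [ENNReal.le_div_iff_mul_le (Or.inl (by simp)) (Or.inl (by finiteness)), posTrace,
    ← ENNReal.tsum_mul_right]
  refine le_trans (ENNReal.tsum_le_tsum fun r => ?_) hN
  by_cases hr : r.2 ∈ F
  · simp [trunc, hr]
  · have h1 : m + 1 ≤ (R.prod a).number r :=
      le_trans (not_le.1 fun h => hr (hF _ h)) (Nat.le_add_left _ _)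
    have h2 : trunc {r : R.idx × a.idx | r.2 ∈ F}ᶜ ρ r r = ρ r r := by simp [trunc, hr]
    rw [h2]
    gcongr
    exact_mod_cast h1

/-- Pointwise convergence of channels implies convergence in the energy-bounded diamond norms if the
number operator of the input has finite-dimensional spectral subspaces. -/
theorem tendsto_boundedDiamond (hE : IsChannel E) (hE' : ∀ i, IsChannel (E' i))
    (h : ∀ (R : QSystem) (ρ : Op (R.prod a).idx), IsState ρ →
      Tendsto (fun i => traceNorm (onRight R.idx E ρ - onRight R.idx (E' i) ρ)) l (𝓝 0))
    (hfin : ∀ m, {x | a.number x ≤ m}.Finite) (N : ℝ≥0) :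
    Tendsto (fun i => boundedDiamond E (E' i) N) l (𝓝 0) := by
  refine ENNReal.tendsto_nhds_zero.2 fun ε hε => ?_
  have hε3 : 0 < ε / 3 := ENNReal.div_pos hε.ne' (by simp)
  -- `η`, the cutoff `m` and the error `δ` below are all chosen before the ancilla and the state,
  -- which makes the estimate uniform over the supremum.
  obtain ⟨η, hη, H⟩ := exists_traceNorm_sub_trunc_le hε3 ENNReal.one_ne_top
  obtain ⟨m, hm⟩ : ∃ m : ℕ, (N : ℝ≥0∞) / (m + 1) ≤ η := by
    obtain ⟨m, hm⟩ := ENNReal.exists_nat_mul_gt hη.ne' (ENNReal.coe_ne_top (r := N))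
    refine ⟨m, (ENNReal.div_le_iff_le_mul (Or.inl (by simp)) (Or.inl (by finiteness))).2 ?_⟩
    refine hm.le.trans ?_
    rw [mul_comm]
    gcongr
    exact le_self_add
  obtain ⟨δ, hδ, Hδ⟩ := exists_tendsto_traceNorm_trunc_le hE hE' h (hfin m).toFinset
  filter_upwards [ENNReal.tendsto_nhds_zero.1 hδ _ hε3] with i hi
  refine iSup_le fun R => iSup_le fun _ => iSup_le fun ρ => iSup_le fun hρ => iSup_le fun hN => ?_
  have htail := (posTrace_trunc_compl_le_of_meanNumber ρ hN (F := (hfin m).toFinset) (m := m)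
    (by simp)).trans hm
  have h1 := H (hE.onRight R.idx) ρ hρ.isPositiveTC (isState_iff.1 hρ).2.le _ htail
  have h2 := H ((hE' i).onRight R.idx) ρ hρ.isPositiveTC (isState_iff.1 hρ).2.le _ htail
  have h3 := (Hδ R.idx ρ hρ i).trans hi
  set M := onRight R.idx E ρ
  set M' := onRight R.idx (E' i) ρ
  set L := onRight R.idx E (trunc {r | r.2 ∈ (hfin m).toFinset} ρ)
  set L' := onRight R.idx (E' i) (trunc {r | r.2 ∈ (hfin m).toFinset} ρ)
  calc traceNorm (M - M') = traceNorm ((M - L) + (L - L') - (M' - L')) := by congr 1; abel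
    _ ≤ ε / 3 + ε / 3 + ε / 3 := (traceNorm_sub_le _ _).trans
        (add_le_add ((traceNorm_add_le _ _).trans (add_le_add h1 h3)) h2)
    _ = ε := ENNReal.add_thirds ε

end BoundedDiamond

/-! ### Stretching with an asymptotic simulation. -/

section Asymptotics

variable {a b A B : QSystem} {I : Type} {l : Filter I} {E : Op a.idx → Op b.idx}
  {T : I → Op ((a.prod A).prod B).idx → Op (QSystem.triv.prod b).idx} {σ : I → Op (A.prod B).idx}

/-- Each simulating channel is stretchable into its own resource by construction, so the stretched
form of its output is exact and only the distance to the ideal output needs a limit. -/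
theorem IsAsymptoticSimulation.exists_stretching (hE : IsChannel E)
    (h : IsAsymptoticSimulation l E T σ) {n : ℕ} {X Y : QSystem} (P : AdaptiveProtocol a b n X Y) :
    ∃ Λ : I → Op ((A.pow n).prod (B.pow n)).idx → Op (X.prod Y).idx, (∀ i, IsLOCC (Λ i)) ∧
      (∀ i, P.output (simulate (T i) (σ i)) = Λ i (tensorPower (σ i) n)) ∧
      Tendsto (fun i => traceNorm (P.output E - Λ i (tensorPower (σ i) n))) l (𝓝 0) := by
  obtain ⟨hT, hσ, hlim⟩ := h
  have hc : ∀ i, IsChannel (simulate (T i) (σ i)) := fun i => isChannel_simulate (hT i).1 (hσ i)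
  choose Λ hΛ e using fun i => P.exists_stretching (hc i) (hσ i) (hT i) fun _ _ => rfl
  refine ⟨Λ, hΛ, e, ?_⟩
  simpa only [e] using P.tendsto_traceNorm_output_sub hE hc hlim

end Asymptotics

end Stretching

/-! ### The stretching lemma. -/

open Stretching in
theorem lemma3 :
    -- channels stretchable into a state, at any dimension
    (∀ (a b : QSystem) (E : Op a.idx → Op b.idx), IsChannel E →
      ∀ (A B : QSystem) (σ : Op (A.prod B).idx), IsStretchable E σ →
      ∀ (n : ℕ) (X Y : QSystem) (P : AdaptiveProtocol a b n X Y),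
        ∃ Λ : Op ((A.pow n).prod (B.pow n)).idx → Op (X.prod Y).idx,
          IsLOCC Λ ∧ P.output E = Λ (tensorPower σ n)) ∧
    -- Choi-stretchable channels
    (∀ (a b : QSystem) (E : Op a.idx → Op b.idx), Finite a.idx → IsChannel E →
      IsStretchable E (choi E) →
      ∀ (n : ℕ) (X Y : QSystem) (P : AdaptiveProtocol a b n X Y),
        ∃ Λ : Op ((a.pow n).prod (b.pow n)).idx → Op (X.prod Y).idx,
          IsLOCC Λ ∧ P.output E = Λ (tensorPower (choi E) n)) ∧
    -- asymptotic simulations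
    (∀ (a b : QSystem) (E : Op a.idx → Op b.idx), IsChannel E →
      ∀ (A B : QSystem) (I : Type) (l : Filter I)
        (T : I → Op ((a.prod A).prod B).idx → Op (QSystem.triv.prod b).idx)
        (σ : I → Op (A.prod B).idx), IsAsymptoticSimulation l E T σ →
      ∀ (n : ℕ) (X Y : QSystem) (P : AdaptiveProtocol a b n X Y),
        ∃ Λ : I → Op ((A.pow n).prod (B.pow n)).idx → Op (X.prod Y).idx,
          (∀ i, IsLOCC (Λ i)) ∧
          (∀ i, P.output (simulate (T i) (σ i)) = Λ i (tensorPower (σ i) n)) ∧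
          Tendsto (fun i => traceNorm (P.output E - Λ i (tensorPower (σ i) n))) l (𝓝 0)) ∧
    -- bosonic channels with an asymptotic simulation over the quasi-Choi matrices
    (∀ (M : Type) [Finite M] (b : QSystem) (E : Op (QSystem.modes M).idx → Op b.idx),
      IsChannel E →
      ∀ (T : ℝ≥0 → Op (((QSystem.modes M).prod (QSystem.modes M)).prod b).idx →
          Op (QSystem.triv.prod b).idx),
      IsAsymptoticSimulation atTop E T (quasiChoi E) →
      ∀ (n : ℕ) (X Y : QSystem) (P : AdaptiveProtocol (QSystem.modes M) b n X Y),
        ∃ Λ : ℝ≥0 → Op (((QSystem.modes M).pow n).prod (b.pow n)).idx → Op (X.prod Y).idx,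
          (∀ t, IsLOCC (Λ t)) ∧
          (∀ t, P.output (simulate (T t) (quasiChoi E t)) =
            Λ t (tensorPower (quasiChoi E t) n)) ∧
          Tendsto (fun t => traceNorm (P.output E - Λ t (tensorPower (quasiChoi E t) n)))
            atTop (𝓝 0)) ∧
    -- bosonic channels: control by the energy-bounded diamond norms
    (∀ (M M' : Type) [Finite M] [Finite M']
      (E : Op (QSystem.modes M).idx → Op (QSystem.modes M').idx), IsChannel E →
      ∀ (A B : QSystem) (I : Type) (l : Filter I)
        (T : I → Op (((QSystem.modes M).prod A).prod B).idx →
          Op (QSystem.triv.prod (QSystem.modes M')).idx)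
        (σ : I → Op (A.prod B).idx), IsAsymptoticSimulation l E T σ →
      (∀ N : ℝ≥0, Tendsto (fun i => boundedDiamond E (simulate (T i) (σ i)) N) l (𝓝 0)) ∧
      ∀ (n : ℕ) (X Y : QSystem) (P : AdaptiveProtocol (QSystem.modes M) (QSystem.modes M') n X Y),
        P.HasBosonicRegisters →
        ∃ Λ : I → Op ((A.pow n).prod (B.pow n)).idx → Op (X.prod Y).idx,
          (∀ i, IsLOCC (Λ i)) ∧
          (∀ i, P.output (simulate (T i) (σ i)) = Λ i (tensorPower (σ i) n)) ∧
          Tendsto (fun i => traceNorm (P.output E - Λ i (tensorPower (σ i) n))) l (𝓝 0) ∧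
          ∀ (N : ℕ → ℝ≥0) (i : I), P.EnergyBounded E N →
            P.EnergyBounded (simulate (T i) (σ i)) N →
            traceNorm (P.output E - Λ i (tensorPower (σ i) n)) ≤
              ∑ k ∈ Finset.range n, boundedDiamond E (simulate (T i) (σ i)) (N k)) := by
  refine ⟨?_, ?_, ?_, ?_, ?_⟩
  · rintro a b E hE A B σ ⟨hσ, T, hT, e⟩ n X Y P
    exact P.exists_stretching hE hσ hT e
  · rintro a b E - hE ⟨hσ, T, hT, e⟩ n X Y P
    exact P.exists_stretching hE hσ hT e
  · intro a b E hE A B I l T σ h n X Y P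
    exact h.exists_stretching hE P
  · intro M _ b E hE T h n X Y P
    exact h.exists_stretching hE P
  · intro M M' _ _ E hE A B I l T σ h
    have hc : ∀ i, IsChannel (simulate (T i) (σ i)) := fun i =>
      isChannel_simulate (h.1 i).1 (h.2.1 i)
    -- Finitely many modes have finitely many occupation vectors below any photon number.
    refine ⟨tendsto_boundedDiamond hE hc h.2.2 Finsupp.finite_of_degree_le,
      fun n X Y P hP => ?_⟩
    obtain ⟨Λ, hΛ, e, ht⟩ := h.exists_stretching hE P
    refine ⟨Λ, hΛ, e, ht, fun N i hN _ => ?_⟩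
    rw [← e i]
    exact P.traceNorm_output_sub_le hE (hc i) hP N hN
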